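/- Let $\mathbb{H}$ be the real quaternions, $t=\frac12(1+i+j+k)$, and let $\Lambda=\mathbb{Z}[1,i,j,t]\subset\mathbb{H}$ be the ring of Hurwitz quaternions. Let $q\in\mathbb{H}$ with $q^2=-1$, and let $T_q=\mathbb{H}/\Lambda$ be the complex torus whose complex structure is the one in which $\sqrt{-1}$ acts on $\mathbb{H}$ by right multiplication by $q$. For a unit $\lambda\in\Lambda^\times$ and $r\in T_q$ let $(\lambda;r)$ be the automorphism $x\mapsto\lambda x+r$ of $T_q$. Put $\alpha=\frac12(1+i)$, $j'=(j;\alpha)$, $k'=(k;\alpha)$, write $i=(i;0)$ and $-1=(-1;0)$, and let $\hat Q_8=\{\pm1,\pm i,\pm j',\pm k'\}$, a group of automorphisms of $T_q$. Let $\pi:T_q\to T_q/\hat Q_8$ be the quotient map; the holomorphic functions on an open set $U\subset T_q/\hat Q_8$ are the functions whose pullback to $\pi^{-1}(U)$ is holomorphic. A point of $T_q/\hat Q_8$ is called smooth if the germ of $T_q/\hat Q_8$ at it is isomorphic to $(\mathbb{C}^2,0)$, singular otherwise, and a singularity of type $A_n$ if this germ is isomorphic to the germ at the origin of $\{xy=z^{n+1}\}\subset\mathbb{C}^3$.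 Then no point of $T_q$ is fixed by all of $\hat Q_8$, and the singularities of $T_q/\hat Q_8$ are $A_1+6A_3$: exactly six points are singularities of type $A_3$, exactly one point is a singularity of type $A_1$, these points are distinct, and they are precisely the singular points of $T_q/\hat Q_8$. Moreover: - For each $g\in\{i,j',k'\}$ the set $\mathrm{Fix}(g)\subset T_q$ consists of four $2$-torsion points, and $\pi(\mathrm{Fix}(g))$ consists of two points. The $A_3$ singularities are the points of $\pi(\mathrm{Fix}(i)\cup\mathrm{Fix}(j')\cup\mathrm{Fix}(k'))$. - Exactly four $2$-torsion points of $T_q$ lie outside $\mathrm{Fix}(i)\cup\mathrm{Fix}(j')\cup\mathrm{Fix}(k')$. They form the $\hat Q_8$-orbit of the class of $\frac12$, and the $A_1$ singularity is their common image under $\pi$. -/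

import Mathlib

open scoped Quaternion Topology

namespace QuaternionTorus

/-! ### The ring of Hurwitz quaternions -/

/-- The quaternion `a + b i + c j + d k`. -/
def quat (a b c d : ℝ) : ℍ[ℝ] := ⟨a, b, c, d⟩

@[simp] theorem quat_re (a b c d : ℝ) : (quat a b c d).re = a := rfl
@[simp] theorem quat_imI (a b c d : ℝ) : (quat a b c d).imI = b := rfl
@[simp] theorem quat_imJ (a b c d : ℝ) : (quat a b c d).imJ = c := rfl
@[simp] theorem quat_imK (a b c d : ℝ) : (quat a b c d).imK = d := rfl

/-- The ring of Hurwitz quaternions `ℤ[1, i, j, t]`, the `ℤ`-span of `1`, `i`, `j` and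
`t = (1 + i + j + k) / 2` in the real quaternions. -/
def hurwitz : Subring ℍ[ℝ] where
  carrier := {x | ∃ a b c d : ℤ, x = (a : ℝ) • (1 : ℍ[ℝ]) + (b : ℝ) • quat 0 1 0 0
    + (c : ℝ) • quat 0 0 1 0 + (d : ℝ) • quat (1 / 2) (1 / 2) (1 / 2) (1 / 2)}
  zero_mem' := ⟨0, 0, 0, 0, by simp⟩
  one_mem' := ⟨1, 0, 0, 0, by simp⟩
  add_mem' := by
    rintro _ _ ⟨a, b, c, d, rfl⟩ ⟨a', b', c', d', rfl⟩
    refine ⟨a + a', b + b', c + c', d + d', ?_⟩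
    push_cast
    module
  neg_mem' := by
    rintro _ ⟨a, b, c, d, rfl⟩
    refine ⟨-a, -b, -c, -d, ?_⟩
    push_cast
    module
  mul_mem' := by
    rintro _ _ ⟨a, b, c, d, rfl⟩ ⟨a', b', c', d', rfl⟩
    refine ⟨a * a' - b * b' - c * c' - d * d' - b * c' + c * b' - b * d' - d * c',
      a * b' + b * a' - b * c' + c * b' + c * d' - d * c' + d * b',
      a * c' + c * a' - b * d' + d * b' - b * c' + c * b' + c * d',
      a * d' + d * a' + d * d' + 2 * (b * c' - c * b') + b * d' - c * d' - d * b' + d * c', ?_⟩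
    ext <;> simp <;> ring

/-- `x = (x₀, x₁, x₂, x₃)` is in the span once its integer coordinates are exhibited. -/
theorem mem_hurwitz_of {x : ℍ[ℝ]} (a b c d : ℤ) (h0 : x.re = a + d / 2) (h1 : x.imI = b + d / 2)
    (h2 : x.imJ = c + d / 2) (h3 : x.imK = d / 2) : x ∈ hurwitz := by
  refine ⟨a, b, c, d, ?_⟩
  ext <;> simp [*] <;> ring

/-- The unit `i` of the ring of Hurwitz quaternions. -/
def unitI : hurwitzˣ where
  val := ⟨quat 0 1 0 0, mem_hurwitz_of 0 1 0 0 (by simp) (by simp) (by simp) (by simp)⟩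
  inv := ⟨quat 0 (-1) 0 0, mem_hurwitz_of 0 (-1) 0 0 (by simp) (by simp) (by simp) (by simp)⟩
  val_inv := by apply Subtype.ext; ext <;> simp
  inv_val := by apply Subtype.ext; ext <;> simp

/-- The unit `j` of the ring of Hurwitz quaternions. -/
def unitJ : hurwitzˣ where
  val := ⟨quat 0 0 1 0, mem_hurwitz_of 0 0 1 0 (by simp) (by simp) (by simp) (by simp)⟩
  inv := ⟨quat 0 0 (-1) 0, mem_hurwitz_of 0 0 (-1) 0 (by simp) (by simp) (by simp) (by simp)⟩
  val_inv := by apply Subtype.ext; ext <;> simp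
  inv_val := by apply Subtype.ext; ext <;> simp

/-- The unit `k` of the ring of Hurwitz quaternions. -/
def unitK : hurwitzˣ where
  val := ⟨quat 0 0 0 1, mem_hurwitz_of (-1) (-1) (-1) 2 (by simp) (by simp) (by simp) (by simp)⟩
  inv := ⟨quat 0 0 0 (-1), mem_hurwitz_of 1 1 1 (-2) (by simp) (by simp) (by simp) (by simp)⟩
  val_inv := by apply Subtype.ext; ext <;> simp
  inv_val := by apply Subtype.ext; ext <;> simp

/-! ### The torus and its affine automorphisms -/

/-- The real torus `ℍ / Λ`, with `Λ` the lattice of Hurwitz quaternions. -/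
abbrev Torus : Type := ℍ[ℝ] ⧸ hurwitz.toAddSubgroup

/-- The projection `ℍ → ℍ / Λ`. -/
def toTorus (x : ℍ[ℝ]) : Torus := QuotientAddGroup.mk x

/-- Left multiplication by a Hurwitz quaternion on the torus. -/
def leftMul (a : hurwitz) : Torus →+ Torus :=
  QuotientAddGroup.map _ _ (AddMonoidHom.mulLeft (a : ℍ[ℝ]))
    (fun _ hx => hurwitz.mul_mem a.2 hx)

theorem leftMul_toTorus (a : hurwitz) (x : ℍ[ℝ]) :
    leftMul a (toTorus x) = toTorus ((a : ℍ[ℝ]) * x) := rfl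

theorem leftMul_leftMul (a b : hurwitz) (x : Torus) :
    leftMul a (leftMul b x) = leftMul (a * b) x := by
  induction x using QuotientAddGroup.induction_on with
  | H x => exact congrArg toTorus (mul_assoc (a : ℍ[ℝ]) (b : ℍ[ℝ]) x).symm

theorem leftMul_one (x : Torus) : leftMul 1 x = x := by
  induction x using QuotientAddGroup.induction_on with
  | H x => exact congrArg toTorus (one_mul x)

/-- The affine automorphism `(l; r) : x ↦ l x + r` of the torus. -/
def affine (l : hurwitzˣ) (r : Torus) : Equiv.Perm Torus where
  toFun x := leftMul l x + r
  invFun x := leftMul (l⁻¹ : hurwitzˣ) (x - r)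
  left_inv x := by simp [leftMul_leftMul, leftMul_one]
  right_inv x := by
    show leftMul l (leftMul (l⁻¹ : hurwitzˣ) (x - r)) + r = x
    simp only [leftMul_leftMul, Units.mul_inv, leftMul_one, sub_add_cancel]

theorem affine_mul (l m : hurwitzˣ) (r s : Torus) :
    affine l r * affine m s = affine (l * m) (leftMul l s + r) := by
  ext x
  simp [affine, leftMul_leftMul, add_assoc]

theorem affine_one : affine 1 0 = 1 := by
  ext x
  simp [affine, leftMul_one]

/-- The point `α = (1 + i) / 2` of the torus. -/
noncomputable def alpha : Torus := toTorus (quat (1 / 2) (1 / 2) 0 0)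

/-- Multiplication by `-1`. -/
def autNeg : Equiv.Perm Torus := affine (-1) 0

/-- The automorphism `i = (i; 0)`. -/
def autI : Equiv.Perm Torus := affine unitI 0

/-- The automorphism `j' = (j; α)`. -/
noncomputable def autJ : Equiv.Perm Torus := affine unitJ alpha

/-- The automorphism `k' = (k; α)`. -/
noncomputable def autK : Equiv.Perm Torus := affine unitK alpha

theorem toTorus_eq_iff {x y : ℍ[ℝ]} : toTorus x = toTorus y ↔ -x + y ∈ hurwitz :=
  QuotientAddGroup.eq

theorem leftMul_alpha_I : leftMul unitI alpha = alpha := by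
  refine toTorus_eq_iff.2 (mem_hurwitz_of 1 0 0 0 ?_ ?_ ?_ ?_) <;> simp [unitI] <;> norm_num

theorem leftMul_alpha_J : leftMul unitJ alpha = alpha := by
  refine toTorus_eq_iff.2 (mem_hurwitz_of 0 0 (-1) 1 ?_ ?_ ?_ ?_) <;> simp [unitJ] <;> norm_num

theorem leftMul_alpha_K : leftMul unitK alpha = alpha := by
  refine toTorus_eq_iff.2 (mem_hurwitz_of 1 1 0 (-1) ?_ ?_ ?_ ?_) <;> simp [unitK] <;> norm_num

theorem leftMul_neg_one (x : Torus) : leftMul ((-1 : hurwitzˣ) : hurwitz) x = -x := by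
  induction x using QuotientAddGroup.induction_on with
  | H x =>
    refine congrArg toTorus (?_ : _ * x = -x)
    simp

theorem alpha_add_alpha : alpha + alpha = 0 := by
  refine (toTorus_eq_iff (x := quat (1 / 2) (1 / 2) 0 0 + quat (1 / 2) (1 / 2) 0 0) (y := 0)).2
    (mem_hurwitz_of (-1) (-1) 0 0 ?_ ?_ ?_ ?_) <;> simp <;> norm_num

theorem neg_alpha : -alpha = alpha := neg_eq_of_add_eq_zero_left alpha_add_alpha

theorem unitI_mul_unitI : unitI * unitI = -1 := by
  apply Units.ext; apply Subtype.ext; ext <;> simp [unitI]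

theorem unitJ_mul_unitJ : unitJ * unitJ = -1 := by
  apply Units.ext; apply Subtype.ext; ext <;> simp [unitJ]

theorem unitK_mul_unitK : unitK * unitK = -1 := by
  apply Units.ext; apply Subtype.ext; ext <;> simp [unitK]

theorem unitI_mul_unitJ : unitI * unitJ = unitK := by
  apply Units.ext; apply Subtype.ext; ext <;> simp [unitI, unitJ, unitK]

theorem unitJ_mul_unitI : unitJ * unitI = -1 * unitK := by
  apply Units.ext; apply Subtype.ext; ext <;> simp [unitI, unitJ, unitK]

theorem autNeg_mul_autNeg : autNeg * autNeg = 1 := by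
  simp [autNeg, affine_mul, affine_one]

theorem autI_mul_autNeg : autI * autNeg = autNeg * autI := by
  simp [autNeg, autI, affine_mul]

theorem autJ_mul_autNeg : autJ * autNeg = autNeg * autJ := by
  have h := leftMul_neg_one alpha
  simp only [Units.val_neg, Units.val_one] at h
  simp [autNeg, autJ, affine_mul, h, neg_alpha]

theorem autI_mul_autI : autI * autI = autNeg := by
  simp [autNeg, autI, affine_mul, unitI_mul_unitI]

theorem autJ_mul_autJ : autJ * autJ = autNeg := by
  simp [autNeg, autJ, affine_mul, unitJ_mul_unitJ, leftMul_alpha_J, alpha_add_alpha]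

theorem autI_mul_autJ : autI * autJ = autK := by
  simp [autI, autJ, autK, affine_mul, unitI_mul_unitJ, leftMul_alpha_I]

theorem autJ_mul_autI : autJ * autI = autNeg * autK := by
  have h := leftMul_neg_one alpha
  simp only [Units.val_neg, Units.val_one] at h
  simp [autNeg, autI, autJ, autK, affine_mul, unitJ_mul_unitI, h, neg_alpha]

/-- The group `{1, -1, i, -i, j', -j', k', -k'}` of affine automorphisms of the torus. -/
def hatQ8 : Subgroup (Equiv.Perm Torus) where
  carrier := {1, autNeg, autI, autNeg * autI, autJ, autNeg * autJ, autK, autNeg * autK}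
  one_mem' := by simp
  mul_mem' := by
    have h1 := autNeg_mul_autNeg
    have h2 := autI_mul_autNeg
    have h3 := autJ_mul_autNeg
    have h4 := autI_mul_autI
    have h5 := autJ_mul_autJ
    have h6 := autJ_mul_autI
    rw [← autI_mul_autJ] at h6 ⊢
    generalize autNeg = m at *
    generalize autI = a at *
    generalize autJ = b at *
    have e1 : ∀ x, m * (m * x) = x := fun x => by rw [← mul_assoc, h1, one_mul]
    have e2 : ∀ x, a * (m * x) = m * (a * x) := fun x => by rw [← mul_assoc, h2, mul_assoc]
    have e3 : ∀ x, b * (m * x) = m * (b * x) := fun x => by rw [← mul_assoc, h3, mul_assoc]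
    have e4 : ∀ x, a * (a * x) = m * x := fun x => by rw [← mul_assoc, h4]
    have e5 : ∀ x, b * (b * x) = m * x := fun x => by rw [← mul_assoc, h5]
    have e6 : ∀ x, b * (a * x) = m * (a * (b * x)) := fun x => by
      rw [← mul_assoc, h6, mul_assoc, mul_assoc]
    rintro x y hx hy
    simp only [Set.mem_insert_iff, Set.mem_singleton_iff] at hx hy ⊢
    rcases hx with rfl | rfl | rfl | rfl | rfl | rfl | rfl | rfl <;>
    rcases hy with rfl | rfl | rfl | rfl | rfl | rfl | rfl | rfl <;>
    simp only [mul_assoc, h1, h2, h3, h4, h5, h6, e1, e2, e3, e4, e5, e6, one_mul, mul_one,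
      true_or, or_true]
  inv_mem' := by
    have h1 := autNeg_mul_autNeg
    have h2 := autI_mul_autNeg
    have h3 := autJ_mul_autNeg
    have h4 := autI_mul_autI
    have h5 := autJ_mul_autJ
    have h6 := autJ_mul_autI
    rw [← autI_mul_autJ] at h6 ⊢
    generalize autNeg = m at *
    generalize autI = a at *
    generalize autJ = b at *
    have e1 : ∀ x, m * (m * x) = x := fun x => by rw [← mul_assoc, h1, one_mul]
    have e2 : ∀ x, a * (m * x) = m * (a * x) := fun x => by rw [← mul_assoc, h2, mul_assoc]
    have e3 : ∀ x, b * (m * x) = m * (b * x) := fun x => by rw [← mul_assoc, h3, mul_assoc]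
    have e4 : ∀ x, a * (a * x) = m * x := fun x => by rw [← mul_assoc, h4]
    have e5 : ∀ x, b * (b * x) = m * x := fun x => by rw [← mul_assoc, h5]
    have e6 : ∀ x, b * (a * x) = m * (a * (b * x)) := fun x => by
      rw [← mul_assoc, h6, mul_assoc, mul_assoc]
    have key : ∀ x y : Equiv.Perm Torus, x * y = 1 →
        y ∈ ({1, m, a, m * a, b, m * b, a * b, m * (a * b)} : Set (Equiv.Perm Torus)) →
        x⁻¹ ∈ ({1, m, a, m * a, b, m * b, a * b, m * (a * b)} : Set (Equiv.Perm Torus)) :=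
      fun x y h hy => by rwa [inv_eq_of_mul_eq_one_right h]
    rintro x (h | h | h | h | h | h | h | h) <;> rw [h]
    · exact key _ 1 (by simp) (by simp)
    · exact key _ m h1 (by simp)
    · exact key _ (m * a) (by simp only [e2, h4, h1]) (by simp)
    · exact key _ a (by simp only [mul_assoc, h4, h1]) (by simp)
    · exact key _ (m * b) (by simp only [e3, h5, h1]) (by simp)
    · exact key _ b (by simp only [mul_assoc, h5, h1]) (by simp)
    · exact key _ (m * (a * b)) (by
        simp only [mul_assoc, h1, h2, h3, h4, h5, h6, e1, e2, e3, e4, e5, e6]) (by simp)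
    · exact key _ (a * b) (by
        simp only [mul_assoc, h1, h2, h3, h4, h5, h6, e1, e2, e3, e4, e5, e6]) (by simp)

/-- The points of the torus fixed by an automorphism. -/
def fix (g : Equiv.Perm Torus) : Set Torus := {x | g x = x}

/-- The `2`-torsion points of the torus. -/
def twoTorsion : Set Torus := {x | x + x = 0}

/-- The quotient of the torus by the group, with the quotient topology. -/
abbrev QuotientSurface : Type := Quotient (MulAction.orbitRel hatQ8 Torus)

/-- The projection from the torus to the quotient surface. -/
def toQuotient (x : Torus) : QuotientSurface := Quotient.mk _ x

/-! ### Complex structures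

A reduced complex space is given by a topological space `X` together with the predicate
`H U f`: "the function `f : X → ℂ` is holomorphic on the open set `U`" (the structure sheaf,
as a subsheaf of the sheaf of continuous functions). -/

/-- Holomorphic functions on open subsets of `ℍ`, for the complex structure in which `√-1` acts
by right multiplication by `q`: real differentiable with `ℂ`-linear differential. -/
def HolQuaternion (q : ℍ[ℝ]) (U : Set ℍ[ℝ]) (f : ℍ[ℝ] → ℂ) : Prop :=
  ∀ x ∈ U, ∃ L : ℍ[ℝ] →L[ℝ] ℂ, HasFDerivAt f L x ∧ ∀ v, L (v * q) = Complex.I * L v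

/-- Holomorphic functions on open subsets of the complex torus `T_q`. -/
def HolTorus (q : ℍ[ℝ]) (U : Set Torus) (f : Torus → ℂ) : Prop :=
  HolQuaternion q (toTorus ⁻¹' U) (f ∘ toTorus)

/-- Holomorphic functions on open subsets of the quotient surface: those whose pullback to the
torus (an invariant function) is holomorphic. -/
def HolQuotient (q : ℍ[ℝ]) (U : Set QuotientSurface) (f : QuotientSurface → ℂ) : Prop :=
  HolTorus q (toQuotient ⁻¹' U) (f ∘ toQuotient)

/-- Holomorphic functions on open subsets of `ℂ²`. -/
def HolPlane (U : Set (ℂ × ℂ)) (f : ℂ × ℂ → ℂ) : Prop := DifferentiableOn ℂ f U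

/-- The surface `x y = z ^ (n + 1)` in `ℂ³`. -/
def ASurface (n : ℕ) : Type := {p : ℂ × ℂ × ℂ // p.1 * p.2.1 = p.2.2 ^ (n + 1)}

instance (n : ℕ) : TopologicalSpace (ASurface n) :=
  inferInstanceAs (TopologicalSpace {p : ℂ × ℂ × ℂ // p.1 * p.2.1 = p.2.2 ^ (n + 1)})

/-- The origin of the surface `x y = z ^ (n + 1)`. -/
def ASurface.origin (n : ℕ) : ASurface n := ⟨(0, 0, 0), by simp⟩

/-- Holomorphic functions on open subsets of `x y = z ^ (n + 1)`: locally the restrictions of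
holomorphic functions of three variables. -/
def HolASurface (n : ℕ) (U : Set (ASurface n)) (f : ASurface n → ℂ) : Prop :=
  ∀ p ∈ U, ∃ (V : Set (ℂ × ℂ × ℂ)) (F : ℂ × ℂ × ℂ → ℂ), IsOpen V ∧ p.1 ∈ V ∧
    DifferentiableOn ℂ F V ∧ ∀ p' ∈ U, p'.1 ∈ V → f p' = F p'.1

/-- The germs of the complex spaces `(X, HX)` at `x` and `(Y, HY)` at `y` are isomorphic: there is
a homeomorphism between open neighbourhoods which sends `x` to `y` and under which the holomorphic
functions on open subsets correspond to each other. -/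
def GermIso {X Y : Type} [TopologicalSpace X] [TopologicalSpace Y]
    (HX : Set X → (X → ℂ) → Prop) (x : X) (HY : Set Y → (Y → ℂ) → Prop) (y : Y) : Prop :=
  ∃ e : OpenPartialHomeomorph X Y, x ∈ e.source ∧ e x = y ∧
    ∀ V : Set Y, IsOpen V → V ⊆ e.target → ∀ f : Y → ℂ,
      (HY V f ↔ HX (e.source ∩ e ⁻¹' V) (f ∘ e))

/-- The surface `T_q / G` is smooth at `p`: its germ is that of `ℂ²` at the origin. -/
def IsSmoothPoint (q : ℍ[ℝ]) (p : QuotientSurface) : Prop :=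
  GermIso (HolQuotient q) p HolPlane (0, 0)

/-- The surface `T_q / G` has a singularity of type `A_n` at `p`: its germ is that of the surface
`x y = z ^ (n + 1)` at the origin. -/
def IsSingularityA (q : ℍ[ℝ]) (n : ℕ) (p : QuotientSurface) : Prop :=
  GermIso (HolQuotient q) p (HolASurface n) (ASurface.origin n)

end QuaternionTorus

/-!
The quotient surface is studied by its projection `proj` from the quaternions. Near a point `x` the
fibres of `proj` are the orbits of the stabilizer of the class of `x`, acting linearly by left
multiplication (`exists_ball_proj_eq_iff`), so the germ of the quotient surface is that of the
quotient of `ℍ ≅ ℂ²` by this linear group (`germIso_of_linear_quotient`). The square of an element of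
the group other than `±1` is `-1`; hence the stabilizer is trivial off the sixteen `2`-torsion
points, and these are coordinatized by `(ℤ / 2) ^ 4`, where `i` and `j'` become explicit affine maps
(`autI_half`, `autJ_half`). A finite computation shows that `Fix i`, `Fix j'`, `Fix k'` are disjoint,
with four points each, and that the four remaining points form one orbit. The stabilizers are
therefore `{±1, ±a}` with `a` one of `i, j, k` on the fixed points, and `{±1}` at the remaining
points.

If `a² = -1`, the quaternions with complex structure `q` have complex coordinates `(u, v)` in which
left multiplication by `a` is `(√-1 u, -√-1 v)` (`exists_coordinates`). The quotient of `ℂ²` by the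
group of `m`-th roots of unity with weights `(1, -1)` is `x y = z ^ m`, by the map
`(u, v) ↦ (u ^ m, v ^ m, u v)`, called `cyclicQuotient`. That this is an isomorphism for the
structure sheaves is `holASurface_iff`: away from the origin the map has local holomorphic sections,
and at the origin an invariant holomorphic function is a holomorphic function of the three
invariants (`exists_eq_of_invariant`). The latter follows from Cauchy's formula with the expansion
`1 / (s - u) = ∑ a < m, s ^ (m - 1 - a) u ^ a / (s ^ m - u ^ m)`, used in each variable and followed
by averaging over the roots of unity.

Finally, the germs of `ℂ²`, `A₁` and `A₃` are pairwise different. The Zariski tangent space of `A_n`,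
`n ≥ 1`, has dimension 3 (`not_germIso_holPlane`), and the tangent cone of `A₃` contains a plane while
that of `A₁` is the cone over a smooth conic (`not_germIso_aSurface_one`).
-/

namespace QuaternionTorus

/-! ### Holomorphic functions of several variables -/

/-- The Fréchet derivative of a holomorphic function on an open subset of a finite-dimensional
space is continuous: by Cauchy's estimate, applied to the difference of two translates of the
function, the derivatives at nearby points differ by little. -/
theorem continuousOn_fderiv_of_differentiableOn {E : Type*} [NormedAddCommGroup E]
    [NormedSpace ℂ E] [FiniteDimensional ℂ E] {U : Set E} (hU : IsOpen U) {g : E → ℂ}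
    (hg : DifferentiableOn ℂ g U) : ContinuousOn (fderiv ℂ g) U := by
  have : ProperSpace E := FiniteDimensional.proper ℂ E
  intro x hx
  apply ContinuousAt.continuousWithinAt
  obtain ⟨R, hR, hRU⟩ := Metric.isOpen_iff.1 hU x hx
  set r := R / 4 with hr
  have hr0 : 0 < r := by positivity
  have huc : UniformContinuousOn g (Metric.closedBall x (2 * r)) :=
    (isCompact_closedBall x (2 * r)).uniformContinuousOn_of_continuous
      (hg.continuousOn.mono fun y hy => hRU (Metric.closedBall_subset_ball (by linarith) hy))
  rw [Metric.continuousAt_iff]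
  intro ε hε
  obtain ⟨δ, hδ, huc⟩ := Metric.uniformContinuousOn_iff.1 huc (ε * r / 2) (by positivity)
  refine ⟨min δ r, lt_min hδ hr0, fun {y} hy => ?_⟩
  rw [dist_eq_norm]
  have hyr : dist y x < r := hy.trans_le (min_le_right _ _)
  have hdiff : ∀ z, dist z x < r → ∀ v : E, ‖v‖ ≤ 1 → ∀ t : ℂ, ‖t‖ ≤ r →
      z + t • v ∈ Metric.closedBall x (2 * r) := by
    intro z hz v hv t ht
    rw [Metric.mem_closedBall, dist_eq_norm]
    calc ‖z + t • v - x‖ = ‖(z - x) + t • v‖ := by congr 1; abel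
      _ ≤ ‖z - x‖ + ‖t • v‖ := norm_add_le _ _
      _ ≤ r + r * 1 := by
        rw [norm_smul, ← dist_eq_norm]
        gcongr
      _ = 2 * r := by ring
  have hsub : Metric.closedBall x (2 * r) ⊆ U := fun y hy =>
    hRU (Metric.closedBall_subset_ball (by linarith) hy)
  have hline : ∀ z, dist z x < r → ∀ v : E, ‖v‖ ≤ 1 → ∀ t : ℂ, ‖t‖ ≤ r →
      HasDerivAt (fun t : ℂ => g (z + t • v)) (fderiv ℂ g (z + t • v) v) t := by
    intro z hz v hv t ht
    have h1 : HasFDerivAt g (fderiv ℂ g (z + t • v)) (z + t • v) :=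
      (hg.differentiableAt (hU.mem_nhds (hsub (hdiff z hz v hv t ht)))).hasFDerivAt
    have h2 : HasDerivAt (fun t : ℂ => z + t • v) v t := by
      simpa using ((hasDerivAt_id t).smul_const v).const_add z
    exact h1.comp_hasDerivAt t h2
  have key : ∀ v : E, ‖v‖ ≤ 1 → ‖(fderiv ℂ g y - fderiv ℂ g x) v‖ ≤ ε / 2 := by
    intro v hv
    have h1 : ∀ t : ℂ, ‖t‖ ≤ r →
        HasDerivAt (fun t : ℂ => g (y + t • v) - g (x + t • v))
          (fderiv ℂ g (y + t • v) v - fderiv ℂ g (x + t • v) v) t := fun t ht =>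
      (hline y hyr v hv t ht).sub (hline x (by simpa using hr0) v hv t ht)
    have h2 : ‖deriv (fun t : ℂ => g (y + t • v) - g (x + t • v)) 0‖ ≤ (ε * r / 2) / r := by
      refine Complex.norm_deriv_le_of_forall_mem_sphere_norm_le hr0 ?_ ?_
      · refine DifferentiableOn.diffContOnCl ?_
        rw [closure_ball _ hr0.ne']
        exact fun t ht => (h1 t (by simpa using ht)).differentiableAt.differentiableWithinAt
      · intro t ht
        have ht' : ‖t‖ ≤ r := by simpa using (mem_sphere_zero_iff_norm.1 ht).le
        rw [← dist_eq_norm]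
        refine (huc _ (hdiff y hyr v hv t ht') _ (hdiff x (by simpa using hr0) v hv t ht') ?_).le
        rw [dist_add_right]
        exact hy.trans_le (min_le_left _ _)
    rw [(h1 0 (by simpa using hr0.le)).deriv] at h2
    simp only [zero_smul, add_zero] at h2
    refine h2.trans (le_of_eq ?_)
    field_simp
  have hnorm := ContinuousLinearMap.opNorm_bound_of_ball_bound one_pos (ε / 2)
    (fderiv ℂ g y - fderiv ℂ g x) fun v hv => key v (by simpa using hv)
  rw [div_one] at hnorm
  linarith

/-- A circle integral depending holomorphically on a parameter is holomorphic in the parameter. -/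
theorem differentiableOn_circleIntegral {E : Type*} [NormedAddCommGroup E]
    [NormedSpace ℂ E] [FiniteDimensional ℂ E] {S : Set ℂ} {U : Set E} (hS : IsOpen S)
    (hU : IsOpen U) {r : ℝ} (hr : 0 ≤ r) (hrS : Metric.sphere (0 : ℂ) r ⊆ S) {F : ℂ × E → ℂ}
    (hF : DifferentiableOn ℂ F (S ×ˢ U)) :
    DifferentiableOn ℂ (fun x => ∮ s in C(0, r), F (s, x)) U := by
  have : ProperSpace E := FiniteDimensional.proper ℂ E
  intro x hx
  apply DifferentiableAt.differentiableWithinAt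
  obtain ⟨R, hR, hRU⟩ := Metric.isOpen_iff.1 hU x hx
  have hc : ∀ θ, circleMap 0 r θ ∈ S := fun θ => hrS (circleMap_mem_sphere 0 hr θ)
  have hF' : ContinuousOn (fderiv ℂ F) (S ×ˢ U) :=
    continuousOn_fderiv_of_differentiableOn (hS.prod hU) hF
  set F' : E → ℝ → E →L[ℂ] ℂ := fun y θ => deriv (circleMap 0 r) θ •
    (fderiv ℂ F (circleMap 0 r θ, y)).comp (ContinuousLinearMap.inr ℂ ℂ E) with hF'def
  have hdc : Continuous (deriv (circleMap 0 r)) := by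
    have : deriv (circleMap 0 r) = fun θ => circleMap 0 r θ * Complex.I := by
      ext θ; simp
    rw [this]
    fun_prop
  have hcont : ContinuousOn (fun p : E × ℝ => F' p.1 p.2) (U ×ˢ Set.univ) := by
    refine ContinuousOn.smul (hdc.comp continuous_snd).continuousOn ?_
    refine ContinuousOn.clm_comp ?_ continuousOn_const
    refine hF'.comp (f := fun p : E × ℝ => (circleMap 0 r p.2, p.1)) (by fun_prop) ?_
    exact fun p hp => ⟨hc _, hp.1⟩
  have hball : Metric.closedBall x (R / 2) ⊆ U := fun y hy =>
    hRU (Metric.closedBall_subset_ball (by linarith) hy)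
  obtain ⟨C, hC⟩ := ((isCompact_closedBall x (R / 2)).prod
    (isCompact_uIcc (a := (0 : ℝ)) (b := 2 * Real.pi))).exists_bound_of_continuousOn
    (hcont.mono (Set.prod_mono hball (Set.subset_univ _)))
  have hFc : ∀ y ∈ U, Continuous fun θ => deriv (circleMap 0 r) θ • F (circleMap 0 r θ, y) := by
    intro y hy
    refine hdc.smul ?_
    exact hF.continuousOn.comp_continuous (by fun_prop) fun θ => ⟨hc θ, hy⟩
  have hF'c : Continuous (F' x) :=
    hcont.comp_continuous (f := fun θ : ℝ => (x, θ)) (by fun_prop) fun θ => ⟨hx, trivial⟩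
  have hmain := intervalIntegral.hasFDerivAt_integral_of_dominated_of_fderiv_le
    (μ := MeasureTheory.volume) (a := 0) (b := 2 * Real.pi) (bound := fun _ => C)
    (F := fun y θ => deriv (circleMap 0 r) θ • F (circleMap 0 r θ, y)) (F' := F') (x₀ := x)
    (s := Metric.ball x (R / 2)) (Metric.ball_mem_nhds x (by positivity))
    (by
      filter_upwards [hU.mem_nhds hx] with y hy using (hFc y hy).aestronglyMeasurable)
    ((hFc x hx).intervalIntegrable _ _) hF'c.aestronglyMeasurable
    (Filter.Eventually.of_forall fun θ hθ y hy =>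
      hC (y, θ) ⟨Metric.ball_subset_closedBall hy, Set.uIoc_subset_uIcc hθ⟩)
    (by simp)
    (Filter.Eventually.of_forall fun θ hθ y hy => by
      have hyU : y ∈ U := hball (Metric.ball_subset_closedBall hy)
      have h1 : HasFDerivAt F (fderiv ℂ F (circleMap 0 r θ, y)) (circleMap 0 r θ, y) :=
        (hF.differentiableAt ((hS.prod hU).mem_nhds ⟨hc θ, hyU⟩)).hasFDerivAt
      have h2 : HasFDerivAt (fun y : E => (circleMap 0 r θ, y))
        (ContinuousLinearMap.inr ℂ ℂ E) y := hasFDerivAt_prodMk_right _ _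
      exact (h1.comp y h2).fun_const_smul _)
  exact hmain.differentiableAt

/-- A function holomorphic in `u` (and a parameter `w`) is, for every `m ≥ 1`, a polynomial of degree
less than `m` in `u` whose coefficients are holomorphic functions of `u ^ m` (and `w`). The
coefficients are read off Cauchy's formula by expanding the kernel as
`1 / (s - u) = ∑ a < m, s ^ (m - 1 - a) u ^ a / (s ^ m - u ^ m)`. -/
theorem exists_root_decomposition {E : Type*} [NormedAddCommGroup E]
    [NormedSpace ℂ E] [FiniteDimensional ℂ E] {W : Set E} (hW : IsOpen W) {R r : ℝ}
    (hr : 0 < r) (hrR : r < R) {m : ℕ} (hm : 0 < m) {g : ℂ × E → ℂ}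
    (hg : DifferentiableOn ℂ g (Metric.ball 0 R ×ˢ W)) :
    ∃ A : ℕ → ℂ × E → ℂ,
      (∀ a, DifferentiableOn ℂ (A a) (Metric.ball 0 (r ^ m) ×ˢ W)) ∧
      ∀ u ∈ Metric.ball (0 : ℂ) r, ∀ w ∈ W,
        g (u, w) = ∑ a ∈ Finset.range m, u ^ a * A a (u ^ m, w) := by
  obtain ⟨t, hrt, htR⟩ := exists_between hrR
  have ht : 0 < t := hr.trans hrt
  set S : Set ℂ := {s | r < ‖s‖ ∧ ‖s‖ < R} with hSdef
  have hS : IsOpen S :=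
    (isOpen_lt continuous_const continuous_norm).inter (isOpen_lt continuous_norm continuous_const)
  have hne : ∀ s : ℂ, r < ‖s‖ → ∀ X ∈ Metric.ball (0 : ℂ) (r ^ m), s ^ m - X ≠ 0 := by
    intro s hs X hX h
    have h1 : ‖X‖ < r ^ m := by simpa using hX
    rw [← sub_eq_zero.1 h, norm_pow] at h1
    exact absurd h1 (not_lt.2 (pow_le_pow_left₀ hr.le hs.le m))
  have htS : Metric.sphere (0 : ℂ) t ⊆ S := by
    intro s hs
    rw [mem_sphere_zero_iff_norm] at hs
    exact ⟨hs ▸ hrt, hs ▸ htR⟩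
  refine ⟨fun a p => (2 * Real.pi * Complex.I)⁻¹ *
    ∮ s in C(0, t), s ^ (m - 1 - a) * (s ^ m - p.1)⁻¹ * g (s, p.2), fun a => ?_, ?_⟩
  · refine DifferentiableOn.const_mul ?_ _
    refine differentiableOn_circleIntegral
      (F := fun x : ℂ × (ℂ × E) => x.1 ^ (m - 1 - a) * (x.1 ^ m - x.2.1)⁻¹ * g (x.1, x.2.2))
      hS (Metric.isOpen_ball.prod hW) ht.le htS ?_
    refine DifferentiableOn.mul (DifferentiableOn.mul (by fun_prop) ?_) ?_
    · refine DifferentiableOn.inv (by fun_prop) ?_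
      rintro ⟨s, X, w⟩ ⟨hs, hX, -⟩
      exact hne s hs.1 X hX
    · refine hg.comp (f := fun x : ℂ × (ℂ × E) => (x.1, x.2.2)) (by fun_prop) ?_
      rintro ⟨s, X, w⟩ ⟨hs, -, hw⟩
      exact ⟨by simpa using hs.2, hw⟩
  · intro u hu w hw
    have hu' : ‖u‖ < r := by simpa using hu
    have hslice : DifferentiableOn ℂ (fun s => g (s, w)) (Metric.ball 0 R) :=
      hg.comp (f := fun s : ℂ => (s, w)) (by fun_prop) fun s hs => ⟨hs, hw⟩
    have hcauchy := DifferentiableOn.circleIntegral_sub_inv_smul (R := t) (c := 0) (w := u)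
      (f := fun s => g (s, w)) (hslice.mono (Metric.closedBall_subset_ball htR))
      (by simpa using hu'.trans hrt)
    have hum : u ^ m ∈ Metric.ball (0 : ℂ) (r ^ m) := by
      simpa using pow_lt_pow_left₀ hu' (norm_nonneg u) hm.ne'
    have hint : ∀ a, CircleIntegrable
        (fun s => s ^ (m - 1 - a) * (s ^ m - u ^ m)⁻¹ * g (s, w)) 0 t := by
      intro a
      refine ContinuousOn.circleIntegrable ht.le ?_
      refine ContinuousOn.mul (ContinuousOn.mul (by fun_prop) ?_) ?_
      · exact ContinuousOn.inv₀ (by fun_prop) fun s hs => hne s (htS hs).1 _ hum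
      · exact hslice.continuousOn.mono fun s hs => by simpa using (htS hs).2
    have hsum : (∮ s in C(0, t), (s - u)⁻¹ • g (s, w)) =
        ∑ a ∈ Finset.range m, u ^ a *
          ∮ s in C(0, t), s ^ (m - 1 - a) * (s ^ m - u ^ m)⁻¹ * g (s, w) := by
      simp only [← circleIntegral.integral_const_mul]
      rw [← circleIntegral.integral_fun_sum fun a _ => ?_]
      · refine circleIntegral.integral_congr ht.le fun s hs => ?_
        have h1 : s ^ m - u ^ m ≠ 0 := hne s (htS hs).1 _ hum
        have h2 := Commute.geom_sum₂_mul (Commute.all u s) m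
        have h3 : s - u ≠ 0 := by
          intro h
          rw [sub_eq_zero.1 h, sub_self] at h1
          exact h1 rfl
        have h4 : ∑ a ∈ Finset.range m, u ^ a * s ^ (m - 1 - a) = (s ^ m - u ^ m) / (s - u) := by
          rw [eq_div_iff h3]
          linear_combination -h2
        show (s - u)⁻¹ * g (s, w) = ∑ a ∈ Finset.range m, _
        calc (s - u)⁻¹ * g (s, w)
            = (∑ a ∈ Finset.range m, u ^ a * s ^ (m - 1 - a)) * (s ^ m - u ^ m)⁻¹ * g (s, w) := by
              rw [h4]; field_simp
          _ = _ := by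
              rw [Finset.sum_mul, Finset.sum_mul]
              exact Finset.sum_congr rfl fun a _ => by ring
      · exact (hint a).const_smul (a := u ^ a)
    have h2pi : (2 * Real.pi * Complex.I : ℂ) ≠ 0 := Complex.two_pi_I_ne_zero
    rw [hsum] at hcauchy
    have : g (u, w) = (2 * Real.pi * Complex.I)⁻¹ * ((2 * Real.pi * Complex.I) • g (u, w)) := by
      rw [smul_eq_mul, inv_mul_cancel_left₀ h2pi]
    rw [this, ← hcauchy, Finset.mul_sum]
    exact Finset.sum_congr rfl fun a _ => by ring

/-! ### The surface `x y = z ^ (n + 1)` as a cyclic quotient of the plane -/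

/-- The map `(u, v) ↦ (u ^ (n + 1), v ^ (n + 1), u v)`, the quotient of `ℂ²` by the group of
`(n + 1)`-st roots of unity `ζ`, acting by `(u, v) ↦ (ζ u, ζ⁻¹ v)`. -/
def cyclicQuotient (n : ℕ) (w : ℂ × ℂ) : ASurface n :=
  ⟨(w.1 ^ (n + 1), w.2 ^ (n + 1), w.1 * w.2), (mul_pow w.1 w.2 (n + 1)).symm⟩

theorem continuous_cyclicQuotient (n : ℕ) : Continuous (cyclicQuotient n) :=
  Continuous.subtype_mk (by fun_prop) _

theorem continuous_val_aSurface (n : ℕ) :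
    Continuous (fun p : ASurface n => (p.1 : ℂ × ℂ × ℂ)) := continuous_subtype_val

theorem cyclicQuotient_zero (n : ℕ) : cyclicQuotient n 0 = ASurface.origin n := by
  apply Subtype.ext
  simp [cyclicQuotient, ASurface.origin]

theorem cyclicQuotient_smul (n : ℕ) {ζ : ℂ} (hζ : ζ ^ (n + 1) = 1) (w : ℂ × ℂ) :
    cyclicQuotient n (ζ * w.1, ζ⁻¹ * w.2) = cyclicQuotient n w := by
  have h0 : ζ ≠ 0 := by
    rintro rfl
    simp at hζ
  apply Subtype.ext
  have h1 : ζ * w.1 * (ζ⁻¹ * w.2) = w.1 * w.2 := by field_simp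
  simp [cyclicQuotient, mul_pow, hζ, h1]

theorem cyclicQuotient_eq_iff (n : ℕ) {w w' : ℂ × ℂ} :
    cyclicQuotient n w = cyclicQuotient n w' ↔
      ∃ ζ : ℂ, ζ ^ (n + 1) = 1 ∧ w' = (ζ * w.1, ζ⁻¹ * w.2) := by
  constructor
  · obtain ⟨u, v⟩ := w
    obtain ⟨u', v'⟩ := w'
    intro h
    have h := congrArg Subtype.val h
    simp only [cyclicQuotient, Prod.mk.injEq] at h
    obtain ⟨hu, hv, huv⟩ := h
    by_cases hu0 : u = 0
    · have hu0' : u' = 0 := by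
        rw [hu0, zero_pow n.succ_ne_zero] at hu
        exact pow_eq_zero_iff n.succ_ne_zero |>.1 hu.symm
      by_cases hv0 : v = 0
      · have hv0' : v' = 0 := by
          rw [hv0, zero_pow n.succ_ne_zero] at hv
          exact pow_eq_zero_iff n.succ_ne_zero |>.1 hv.symm
        exact ⟨1, by simp, by simp [*]⟩
      · have hv0' : v' ≠ 0 := by
          rintro rfl
          rw [zero_pow n.succ_ne_zero] at hv
          exact hv0 (pow_eq_zero_iff n.succ_ne_zero |>.1 hv)
        refine ⟨v / v', ?_, ?_⟩
        · rw [div_pow, hv, div_self (pow_ne_zero _ hv0')]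
        · simp only [hu0, hu0', mul_zero, Prod.mk.injEq, true_and]
          field_simp
    · refine ⟨u' / u, ?_, ?_⟩
      · rw [div_pow, ← hu, div_self (pow_ne_zero _ hu0)]
      · have hu0' : u' ≠ 0 := by
          rintro rfl
          rw [zero_pow n.succ_ne_zero] at hu
          exact hu0 (pow_eq_zero_iff n.succ_ne_zero |>.1 hu)
        simp only [Prod.mk.injEq]
        constructor
        · field_simp
        · field_simp
          linear_combination -huv
  · rintro ⟨ζ, hζ, rfl⟩
    exact (cyclicQuotient_smul n hζ w).symm

theorem surjective_cyclicQuotient (n : ℕ) : Function.Surjective (cyclicQuotient n) := by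
  rintro ⟨⟨x, y, z⟩, h⟩
  by_cases hx : x = 0
  · obtain ⟨v, hv⟩ := IsAlgClosed.exists_pow_nat_eq y n.succ_pos
    refine ⟨(0, v), Subtype.ext ?_⟩
    simp only [hx, zero_mul] at h
    have hz := pow_eq_zero_iff n.succ_ne_zero |>.1 h.symm
    simp [cyclicQuotient, hx, hz, hv]
  · obtain ⟨u, hu⟩ := IsAlgClosed.exists_pow_nat_eq x n.succ_pos
    have hu0 : u ≠ 0 := by
      rintro rfl
      exact hx (by rw [← hu, zero_pow n.succ_ne_zero])
    refine ⟨(u, z / u), Subtype.ext ?_⟩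
    simp only [cyclicQuotient, Prod.mk.injEq, div_pow]
    refine ⟨hu, ?_, by field_simp⟩
    simp only at h
    rw [← h, ← hu]
    field_simp

theorem isClosedMap_cyclicQuotient (n : ℕ) : IsClosedMap (cyclicQuotient n) := by
  have hproper : IsProperMap (fun w : ℂ × ℂ => (cyclicQuotient n w).1) := by
    refine isProperMap_iff_tendsto_cocompact.2
      ⟨(continuous_val_aSurface n).comp (continuous_cyclicQuotient n), ?_⟩
    rw [← Metric.cobounded_eq_cocompact, ← Metric.cobounded_eq_cocompact,
      ← tendsto_norm_atTop_iff_cobounded]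
    refine Filter.tendsto_atTop_mono' _ ?_ tendsto_norm_cobounded_atTop
    filter_upwards [tendsto_norm_cobounded_atTop.eventually_ge_atTop 1] with w hw
    have hle : ∀ c : ℂ, 1 ≤ ‖c‖ → ‖c‖ ≤ ‖c ^ (n + 1)‖ := fun c hc => by
      rw [norm_pow]
      exact le_self_pow₀ hc n.succ_ne_zero
    simp only [cyclicQuotient, Prod.norm_def] at hw ⊢
    rcases le_total ‖w.1‖ ‖w.2‖ with h | h
    · rw [max_eq_right h] at hw ⊢
      exact (hle _ hw).trans ((le_max_left _ _).trans (le_max_right _ _))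
    · rw [max_eq_left h] at hw ⊢
      exact (hle _ hw).trans (le_max_left _ _)
  intro C hC
  have h := (hproper.isClosedMap C hC).preimage (continuous_val_aSurface n)
  convert h using 1
  ext p
  constructor
  · rintro ⟨w, hw, rfl⟩
    exact ⟨w, hw, rfl⟩
  · rintro ⟨w, hw, h⟩
    exact ⟨w, hw, Subtype.ext h⟩

theorem isOpenMap_cyclicQuotient (n : ℕ) : IsOpenMap (cyclicQuotient n) := by
  intro U hU
  -- the saturation of `U` is open, and its complement has closed image
  set S : Set (ℂ × ℂ) := {w | ∃ ζ : ℂ, ζ ^ (n + 1) = 1 ∧ (ζ * w.1, ζ⁻¹ * w.2) ∈ U} with hS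
  have hSo : IsOpen S := by
    have : S = ⋃ ζ ∈ {ζ : ℂ | ζ ^ (n + 1) = 1},
        (fun w : ℂ × ℂ => (ζ * w.1, ζ⁻¹ * w.2)) ⁻¹' U := by
      ext w; simp [hS]
    rw [this]
    exact isOpen_biUnion fun ζ _ => hU.preimage (by fun_prop)
  have himage : cyclicQuotient n '' U = (cyclicQuotient n '' Sᶜ)ᶜ := by
    ext p
    constructor
    · rintro ⟨w, hw, rfl⟩ ⟨w', hw', h⟩
      obtain ⟨ζ, hζ, rfl⟩ := (cyclicQuotient_eq_iff n).1 h
      exact hw' ⟨ζ, hζ, hw⟩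
    · intro hp
      obtain ⟨w, rfl⟩ := surjective_cyclicQuotient n p
      by_contra hpU
      refine hp ⟨w, ?_, rfl⟩
      rintro ⟨ζ, hζ, hw⟩
      exact hpU ⟨_, hw, cyclicQuotient_smul n hζ w⟩
  rw [himage]
  exact (isClosedMap_cyclicQuotient n _ hSo.isClosed_compl).isOpen_compl

/-- A holomorphic function of two variables near the origin which is invariant under
`(u, v) ↦ (ζ u, ζ⁻¹ v)` for all `m`-th roots of unity `ζ` is a holomorphic function of `u ^ m`,
`v ^ m` and `u v`: decompose in both variables and average over the roots of unity. -/
theorem exists_eq_of_invariant {m : ℕ} (hm : 0 < m) {R r : ℝ} (hr : 0 < r) (hrR : r < R)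
    {g : ℂ × ℂ → ℂ} (hg : DifferentiableOn ℂ g (Metric.ball 0 R ×ˢ Metric.ball 0 R))
    (hinv : ∀ ζ : ℂ, ζ ^ m = 1 → ∀ u v, g (ζ * u, ζ⁻¹ * v) = g (u, v)) :
    ∃ G : ℂ × ℂ × ℂ → ℂ,
      DifferentiableOn ℂ G
        (Metric.ball 0 (r ^ m) ×ˢ Metric.ball 0 (r ^ m) ×ˢ Metric.ball 0 (r ^ m)) ∧
      ∀ u ∈ Metric.ball (0 : ℂ) r, ∀ v ∈ Metric.ball (0 : ℂ) r,
        g (u, v) = G (u ^ m, v ^ m, u * v) := by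
  obtain ⟨A, hA, hgA⟩ := exists_root_decomposition Metric.isOpen_ball hr hrR hm hg
  have hA' : ∀ a, DifferentiableOn ℂ (fun p : ℂ × ℂ => A a (p.2, p.1))
      (Metric.ball 0 R ×ˢ Metric.ball 0 (r ^ m)) := fun a =>
    (hA a).comp (f := fun p : ℂ × ℂ => (p.2, p.1)) (by fun_prop) fun p hp => ⟨hp.2, hp.1⟩
  choose B hB hAB using fun a =>
    exists_root_decomposition Metric.isOpen_ball hr hrR hm (hA' a)
  refine ⟨fun P => ∑ a ∈ Finset.range m, P.2.2 ^ a * B a a (P.2.1, P.1), ?_, ?_⟩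
  · refine DifferentiableOn.fun_sum fun a _ => DifferentiableOn.mul (by fun_prop) ?_
    exact (hB a a).comp (f := fun P : ℂ × ℂ × ℂ => (P.2.1, P.1)) (by fun_prop)
      fun P hP => ⟨hP.2.1, hP.1⟩
  · intro u hu v hv
    have hm0 : m ≠ 0 := hm.ne'
    set ζ := Complex.exp (2 * Real.pi * Complex.I / m) with hζdef
    have hζ : IsPrimitiveRoot ζ m := Complex.isPrimitiveRoot_exp m hm0
    have hζ0 : ζ ≠ 0 := hζ.ne_zero hm0
    have hexp : ∀ u ∈ Metric.ball (0 : ℂ) r, ∀ v ∈ Metric.ball (0 : ℂ) r,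
        g (u, v) = ∑ a ∈ Finset.range m, ∑ b ∈ Finset.range m,
          u ^ a * v ^ b * B a b (v ^ m, u ^ m) := by
      intro u hu v hv
      have hum : u ^ m ∈ Metric.ball (0 : ℂ) (r ^ m) := by
        have : ‖u‖ < r := by simpa using hu
        simpa using pow_lt_pow_left₀ this (norm_nonneg u) hm0
      rw [hgA u hu v (Metric.ball_subset_ball hrR.le hv)]
      refine Finset.sum_congr rfl fun a _ => ?_
      have h1 := hAB a v hv (u ^ m) hum
      simp only at h1
      rw [h1, Finset.mul_sum]
      exact Finset.sum_congr rfl fun b _ => by ring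
    have hnorm : ‖ζ‖ = 1 := hζ.norm'_eq_one hm0
    have hrot : ∀ k ∈ Finset.range m, g (u, v) = ∑ a ∈ Finset.range m, ∑ b ∈ Finset.range m,
        (ζ ^ a * (ζ⁻¹) ^ b) ^ k * (u ^ a * v ^ b * B a b (v ^ m, u ^ m)) := by
      intro k _
      have hk : (ζ ^ k) ^ m = 1 := by rw [← pow_mul, mul_comm, pow_mul, hζ.pow_eq_one, one_pow]
      rw [← hinv (ζ ^ k) hk, hexp]
      · refine Finset.sum_congr rfl fun a _ => Finset.sum_congr rfl fun b _ => ?_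
        rw [mul_pow (ζ ^ k) u m, mul_pow (ζ ^ k)⁻¹ v m, inv_pow, hk, inv_one, one_mul, one_mul]
        rw [mul_pow, mul_pow, mul_pow, ← pow_mul, ← pow_mul, ← pow_mul, inv_pow, inv_pow,
          ← pow_mul, mul_comm a k, mul_comm b k]
        ring
      · simpa [hnorm] using hu
      · simpa [hnorm] using hv
    have hgeom : ∀ a ∈ Finset.range m, ∀ b ∈ Finset.range m,
        ∑ k ∈ Finset.range m, (ζ ^ a * (ζ⁻¹) ^ b) ^ k = if a = b then (m : ℂ) else 0 := by
      intro a ha b hb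
      split_ifs with hab
      · subst hab
        simp [hζ0]
      · have hc : ζ ^ a * (ζ⁻¹) ^ b ≠ 1 := by
          rw [inv_pow, ← div_eq_mul_inv, Ne, div_eq_one_iff_eq (pow_ne_zero _ hζ0)]
          exact fun h => hab (hζ.pow_inj (Finset.mem_range.1 ha) (Finset.mem_range.1 hb) h)
        rw [geom_sum_eq hc, mul_pow, ← pow_mul, ← pow_mul, mul_comm a, mul_comm b, pow_mul,
          pow_mul, inv_pow, hζ.pow_eq_one]
        simp
    have hsum : (m : ℂ) * g (u, v) =
        (m : ℂ) * ∑ a ∈ Finset.range m, (u * v) ^ a * B a a (v ^ m, u ^ m) := by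
      calc (m : ℂ) * g (u, v) = ∑ k ∈ Finset.range m, g (u, v) := by simp
        _ = ∑ k ∈ Finset.range m, ∑ a ∈ Finset.range m, ∑ b ∈ Finset.range m,
            (ζ ^ a * (ζ⁻¹) ^ b) ^ k * (u ^ a * v ^ b * B a b (v ^ m, u ^ m)) :=
          Finset.sum_congr rfl hrot
        _ = ∑ a ∈ Finset.range m, ∑ b ∈ Finset.range m,
            (∑ k ∈ Finset.range m, (ζ ^ a * (ζ⁻¹) ^ b) ^ k) *
              (u ^ a * v ^ b * B a b (v ^ m, u ^ m)) := by
          rw [Finset.sum_comm]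
          refine Finset.sum_congr rfl fun a _ => ?_
          rw [Finset.sum_comm]
          exact Finset.sum_congr rfl fun b _ => by rw [Finset.sum_mul]
        _ = _ := by
          rw [Finset.mul_sum]
          refine Finset.sum_congr rfl fun a ha => ?_
          rw [Finset.sum_eq_single_of_mem a ha]
          · rw [hgeom a ha a ha, if_pos rfl]
            ring
          · intro b hb hba
            rw [hgeom a ha b hb, if_neg hba.symm, zero_mul]
    exact mul_left_cancel₀ (Nat.cast_ne_zero.2 hm0) hsum

/-- Away from the origin of `ℂ` there are local holomorphic branches of the `m`-th root. -/
theorem exists_local_root {m : ℕ} (hm : m ≠ 0) {x₀ : ℂ} (hx₀ : x₀ ≠ 0) :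
    ∃ ρ : ℂ → ℂ, ∀ᶠ x in 𝓝 x₀, DifferentiableAt ℂ ρ x ∧ ρ x ^ m = x ∧ ρ x ≠ 0 := by
  obtain ⟨u₀, hu₀⟩ := IsAlgClosed.exists_pow_nat_eq x₀ (Nat.pos_of_ne_zero hm)
  have hu₀' : u₀ ≠ 0 := by
    rintro rfl
    exact hx₀ (by rw [← hu₀, zero_pow hm])
  refine ⟨fun x => u₀ * Complex.exp (Complex.log (x / x₀) / m), ?_⟩
  have h1 : ∀ᶠ x in 𝓝 x₀, x / x₀ ∈ Complex.slitPlane := by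
    refine ContinuousAt.eventually_mem (f := fun x => x / x₀) (by fun_prop) ?_
    rw [div_self hx₀]
    exact Complex.isOpen_slitPlane.mem_nhds Complex.one_mem_slitPlane
  filter_upwards [h1] with x hx
  refine ⟨?_, ?_, mul_ne_zero hu₀' (Complex.exp_ne_zero _)⟩
  · have : DifferentiableAt ℂ (fun x => Complex.log (x / x₀)) x :=
      DifferentiableAt.clog (by fun_prop) hx
    fun_prop
  · rw [mul_pow, ← Complex.exp_nat_mul, mul_div_cancel₀ _ (Nat.cast_ne_zero.2 hm),
      Complex.exp_log (Complex.slitPlane_ne_zero hx), hu₀]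
    field_simp

/-- At every point of the surface other than the origin, the quotient map has a local section which
is the restriction of a holomorphic map on an open subset of `ℂ³`. -/
theorem exists_local_section (n : ℕ) {p : ASurface n} (hp : p ≠ ASurface.origin n) :
    ∃ s : ℂ × ℂ × ℂ → ℂ × ℂ, ∀ᶠ P in 𝓝 p.1, DifferentiableAt ℂ s P ∧
      ∀ h : P.1 * P.2.1 = P.2.2 ^ (n + 1), cyclicQuotient n (s P) = ⟨P, h⟩ := by
  obtain ⟨⟨x, y, z⟩, hxyz⟩ := p
  by_cases hx : x = 0
  · have hy : y ≠ 0 := by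
      rintro rfl
      simp only [hx, zero_mul] at hxyz
      have hz := pow_eq_zero_iff n.succ_ne_zero |>.1 hxyz.symm
      exact hp (Subtype.ext (by simp [hx, hz, ASurface.origin]))
    obtain ⟨ρ, hρ⟩ := exists_local_root n.succ_ne_zero hy
    refine ⟨fun P => (P.2.2 / ρ P.2.1, ρ P.2.1), ?_⟩
    have hev : Filter.Tendsto (fun P : ℂ × ℂ × ℂ => P.2.1) (𝓝 (x, y, z)) (𝓝 y) :=
      Continuous.tendsto' (by fun_prop) _ _ rfl
    filter_upwards [hev.eventually hρ] with P ⟨hd, hpow, hne⟩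
    have hd' : DifferentiableAt ℂ (fun P : ℂ × ℂ × ℂ => ρ P.2.1) P :=
      DifferentiableAt.comp P (g := ρ) (f := fun P : ℂ × ℂ × ℂ => P.2.1) hd (by fun_prop)
    have hq : DifferentiableAt ℂ (fun P : ℂ × ℂ × ℂ => P.2.2 / ρ P.2.1) P := by
      fun_prop (disch := exact hne)
    refine ⟨hq.prodMk hd', fun h => ?_⟩
    apply Subtype.ext
    refine Prod.ext ?_ (Prod.ext hpow ?_)
    · simp only [cyclicQuotient, div_pow, ← h]
      rw [hpow]
      have : P.2.1 ≠ 0 := by rw [← hpow]; exact pow_ne_zero _ hne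
      field_simp
    · simp only [cyclicQuotient]
      field_simp
  · obtain ⟨ρ, hρ⟩ := exists_local_root n.succ_ne_zero hx
    refine ⟨fun P => (ρ P.1, P.2.2 / ρ P.1), ?_⟩
    have hev : Filter.Tendsto (fun P : ℂ × ℂ × ℂ => P.1) (𝓝 (x, y, z)) (𝓝 x) :=
      Continuous.tendsto' (by fun_prop) _ _ rfl
    filter_upwards [hev.eventually hρ] with P ⟨hd, hpow, hne⟩
    have hd' : DifferentiableAt ℂ (fun P : ℂ × ℂ × ℂ => ρ P.1) P :=
      DifferentiableAt.comp P (g := ρ) (f := fun P : ℂ × ℂ × ℂ => P.1) hd (by fun_prop)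
    have hq : DifferentiableAt ℂ (fun P : ℂ × ℂ × ℂ => P.2.2 / ρ P.1) P := by
      fun_prop (disch := exact hne)
    refine ⟨hd'.prodMk hq, fun h => ?_⟩
    apply Subtype.ext
    refine Prod.ext hpow (Prod.ext ?_ ?_)
    · simp only [cyclicQuotient, div_pow, ← h]
      rw [hpow]
      have : P.1 ≠ 0 := by rw [← hpow]; exact pow_ne_zero _ hne
      field_simp
    · simp only [cyclicQuotient]
      field_simp

/-- The holomorphic functions on `x y = z ^ (n + 1)`, defined by local extension to `ℂ³`, are the
functions whose pullback to `ℂ²` is holomorphic. -/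
theorem holASurface_iff (n : ℕ) {V : Set (ASurface n)} (hV : IsOpen V) (f : ASurface n → ℂ) :
    HolASurface n V f ↔ DifferentiableOn ℂ (f ∘ cyclicQuotient n) (cyclicQuotient n ⁻¹' V) := by
  have hVo : IsOpen (cyclicQuotient n ⁻¹' V) := hV.preimage (continuous_cyclicQuotient n)
  have hval : Continuous (fun w : ℂ × ℂ => (cyclicQuotient n w).1) :=
    (continuous_val_aSurface n).comp (continuous_cyclicQuotient n)
  constructor
  · intro h w hw
    obtain ⟨V', F, hV', hwV', hF, hfF⟩ := h _ hw
    have h1 : DifferentiableAt ℂ (fun w : ℂ × ℂ => F (cyclicQuotient n w).1) w := by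
      refine DifferentiableAt.comp w (hF.differentiableAt (hV'.mem_nhds hwV')) ?_
      simp only [cyclicQuotient]
      fun_prop
    refine (h1.congr_of_eventuallyEq ?_).differentiableWithinAt
    filter_upwards [hVo.mem_nhds hw, (hV'.preimage hval).mem_nhds hwV'] with w' h2 h3
    exact hfF _ h2 h3
  · intro h p hp
    suffices hsuff : ∃ F : ℂ × ℂ × ℂ → ℂ, ∀ᶠ P in 𝓝 p.1, DifferentiableAt ℂ F P ∧
        ∀ h : P.1 * P.2.1 = P.2.2 ^ (n + 1), f ⟨P, h⟩ = F P by
      obtain ⟨F, hF⟩ := hsuff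
      obtain ⟨V', hV'F, hV', hpV'⟩ := eventually_nhds_iff.1 hF
      exact ⟨V', F, hV', hpV', fun P hP => (hV'F P hP).1.differentiableWithinAt,
        fun p' _ hp' => (hV'F p'.1 hp').2 p'.2⟩
    by_cases hp0 : p = ASurface.origin n
    · subst hp0
      have h0 : (0 : ℂ × ℂ) ∈ cyclicQuotient n ⁻¹' V := by
        rw [Set.mem_preimage, cyclicQuotient_zero]
        exact hp
      obtain ⟨R, hR, hRV⟩ := Metric.isOpen_iff.1 hVo 0 h0
      have hball : Metric.ball (0 : ℂ) R ×ˢ Metric.ball (0 : ℂ) R = Metric.ball (0 : ℂ × ℂ) R :=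
        ball_prod_same _ _ _
      obtain ⟨G, hG, hfG⟩ := exists_eq_of_invariant (m := n + 1) n.succ_pos (half_pos hR)
        (half_lt_self hR) (hball ▸ h.mono hRV)
        (fun ζ hζ u v => congrArg f (cyclicQuotient_smul n hζ (u, v)))
      refine ⟨G, ?_⟩
      have hr : 0 < (R / 2) ^ (n + 1) := by positivity
      have hmem : Metric.ball (0 : ℂ) ((R / 2) ^ (n + 1)) ×ˢ
          Metric.ball (0 : ℂ) ((R / 2) ^ (n + 1)) ×ˢ
          Metric.ball (0 : ℂ) ((R / 2) ^ (n + 1)) ∈ 𝓝 (ASurface.origin n).1 :=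
        prod_mem_nhds (Metric.ball_mem_nhds _ hr)
          (prod_mem_nhds (Metric.ball_mem_nhds _ hr) (Metric.ball_mem_nhds _ hr))
      filter_upwards [eventually_mem_nhds_iff.2 hmem] with P hP
      refine ⟨hG.differentiableAt hP, fun hPs => ?_⟩
      obtain ⟨w, hw⟩ := surjective_cyclicQuotient n ⟨P, hPs⟩
      have hw' := congrArg Subtype.val hw
      simp only [cyclicQuotient] at hw'
      have hP' := mem_of_mem_nhds hP
      rw [← hw'] at hP'
      have hlt : ∀ c : ℂ, c ^ (n + 1) ∈ Metric.ball (0 : ℂ) ((R / 2) ^ (n + 1)) →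
          c ∈ Metric.ball (0 : ℂ) (R / 2) := fun c hc => by
        rw [mem_ball_zero_iff, norm_pow] at hc
        exact mem_ball_zero_iff.2 (lt_of_pow_lt_pow_left₀ _ (by positivity) hc)
      have := hfG w.1 (hlt _ hP'.1) w.2 (hlt _ hP'.2.1)
      rw [hw'] at this
      rw [← this, ← hw]
      rfl
    · obtain ⟨s, hs⟩ := exists_local_section n hp0
      have hsp := hs.self_of_nhds
      refine ⟨fun P => f (cyclicQuotient n (s P)), ?_⟩
      have hmem : cyclicQuotient n ⁻¹' V ∈ 𝓝 (s p.1) := by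
        refine hVo.mem_nhds ?_
        rw [Set.mem_preimage, hsp.2 p.2]
        exact hp
      filter_upwards [hs, hsp.1.continuousAt.eventually_mem hmem] with P hP hPV
      refine ⟨?_, fun hPs => by rw [hP.2 hPs]⟩
      exact DifferentiableAt.comp P (g := f ∘ cyclicQuotient n)
        (h.differentiableAt (hVo.mem_nhds hPV)) hP.1

/-! ### Isomorphisms of germs -/

/-- If the holomorphic functions correspond to each other under a local homeomorphism, they do so
under its inverse. -/
theorem hol_iff_symm {X Y : Type} [TopologicalSpace X] [TopologicalSpace Y]
    {HX : Set X → (X → ℂ) → Prop} {HY : Set Y → (Y → ℂ) → Prop}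
    (hX : ∀ U, IsOpen U → ∀ f g : X → ℂ, Set.EqOn f g U → HX U f → HX U g)
    {e : OpenPartialHomeomorph X Y}
    (he : ∀ V : Set Y, IsOpen V → V ⊆ e.target → ∀ f : Y → ℂ,
      (HY V f ↔ HX (e.source ∩ e ⁻¹' V) (f ∘ e)))
    (U : Set X) (hU : IsOpen U) (hUs : U ⊆ e.symm.target) (f : X → ℂ) :
    HX U f ↔ HY (e.symm.source ∩ e.symm ⁻¹' U) (f ∘ e.symm) := by
  have hUs' : U ⊆ e.source := hUs
  have hset : e.source ∩ e ⁻¹' (e.symm.source ∩ e.symm ⁻¹' U) = U := by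
    ext z
    constructor
    · rintro ⟨hz, -, hz'⟩
      rwa [Set.mem_preimage, e.left_inv hz] at hz'
    · intro hz
      refine ⟨hUs' hz, e.map_source (hUs' hz), ?_⟩
      rwa [Set.mem_preimage, e.left_inv (hUs' hz)]
  rw [he _ (e.symm.isOpen_inter_preimage hU) Set.inter_subset_left, hset]
  have heq : Set.EqOn f ((f ∘ e.symm) ∘ e) U := fun z hz => by
    simp [e.left_inv (hUs' hz)]
  exact ⟨hX U hU _ _ heq, hX U hU _ _ heq.symm⟩

theorem GermIso.symm {X Y : Type} [TopologicalSpace X] [TopologicalSpace Y]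
    {HX : Set X → (X → ℂ) → Prop} {x : X} {HY : Set Y → (Y → ℂ) → Prop} {y : Y}
    (hX : ∀ U, IsOpen U → ∀ f g : X → ℂ, Set.EqOn f g U → HX U f → HX U g)
    (h : GermIso HX x HY y) : GermIso HY y HX x := by
  obtain ⟨e, hx, rfl, he⟩ := h
  exact ⟨e.symm, e.map_source hx, e.left_inv hx, hol_iff_symm hX he⟩

theorem GermIso.trans {X Y Z : Type} [TopologicalSpace X] [TopologicalSpace Y]
    [TopologicalSpace Z] {HX : Set X → (X → ℂ) → Prop} {x : X} {HY : Set Y → (Y → ℂ) → Prop}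
    {y : Y} {HZ : Set Z → (Z → ℂ) → Prop} {z : Z}
    (h : GermIso HX x HY y) (h' : GermIso HY y HZ z) : GermIso HX x HZ z := by
  obtain ⟨e, hx, rfl, he⟩ := h
  obtain ⟨e', hy, rfl, he'⟩ := h'
  refine ⟨e.trans e', by simp [hx, hy], rfl, fun V hV hVt f => ?_⟩
  rw [OpenPartialHomeomorph.trans_target] at hVt
  rw [he' V hV fun v hv => (hVt hv).1]
  rw [he _ (e'.isOpen_inter_preimage hV) ?_]
  · rw [OpenPartialHomeomorph.trans_source]
    refine iff_of_eq (congrArg₂ HX ?_ rfl)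
    ext w
    simp [and_assoc]
  · rintro w ⟨hw, hwV⟩
    have := (hVt hwV).2
    rwa [Set.mem_preimage, e'.left_inv hw] at this

theorem holQuotient_congr (q : ℍ[ℝ]) (U : Set QuotientSurface) (hU : IsOpen U)
    (f g : QuotientSurface → ℂ) (hfg : Set.EqOn f g U) (hf : HolQuotient q U f) :
    HolQuotient q U g := by
  have hc : Continuous fun x : ℍ[ℝ] => toQuotient (toTorus x) :=
    continuous_quot_mk.comp continuous_quot_mk
  intro x hx
  obtain ⟨L, hL, hLq⟩ := hf x hx
  refine ⟨L, hL.congr_of_eventuallyEq ?_, hLq⟩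
  filter_upwards [(hU.preimage hc).mem_nhds hx] with y hy
  exact (hfg hy).symm

theorem holASurface_congr (n : ℕ) (U : Set (ASurface n)) (_ : IsOpen U) (f g : ASurface n → ℂ)
    (hfg : Set.EqOn f g U) (hf : HolASurface n U f) : HolASurface n U g := by
  intro p hp
  obtain ⟨V, F, hV, hpV, hF, hfF⟩ := hf p hp
  exact ⟨V, F, hV, hpV, hF, fun p' hp' hp'V => (hfg hp').symm.trans (hfF p' hp' hp'V)⟩

/-! ### The germs of `ℂ²` and of the surfaces `x y = z ^ (n + 1)` are pairwise different -/

theorem holASurface_comp_val (n : ℕ) (U : Set (ASurface n)) {F : ℂ × ℂ × ℂ → ℂ}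
    (hF : Differentiable ℂ F) : HolASurface n U (fun p => F p.1) := fun _ _ =>
  ⟨Set.univ, F, isOpen_univ, trivial, hF.differentiableOn, fun _ _ _ => rfl⟩

theorem eventually_mem_of_isOpen {n : ℕ} {U : Set (ASurface n)} (hU : IsOpen U)
    (h0 : ASurface.origin n ∈ U) :
    ∀ᶠ P in 𝓝 (0 : ℂ × ℂ × ℂ), ∀ h : P.1 * P.2.1 = P.2.2 ^ (n + 1),
      (⟨P, h⟩ : ASurface n) ∈ U := by
  obtain ⟨U', hU', rfl⟩ := isOpen_induced_iff.1 hU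
  filter_upwards [hU'.mem_nhds h0] with P hP h using hP

theorem exists_extension_of_holASurface {n : ℕ} {U : Set (ASurface n)} (hU : IsOpen U)
    (h0 : ASurface.origin n ∈ U) {f : ASurface n → ℂ} (hf : HolASurface n U f) :
    ∃ F : ℂ × ℂ × ℂ → ℂ, DifferentiableAt ℂ F 0 ∧
      ∀ᶠ P in 𝓝 (0 : ℂ × ℂ × ℂ), ∀ h : P.1 * P.2.1 = P.2.2 ^ (n + 1), f ⟨P, h⟩ = F P := by
  obtain ⟨V, F, hV, h0V, hF, hfF⟩ := hf _ h0
  refine ⟨F, hF.differentiableAt (hV.mem_nhds h0V), ?_⟩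
  filter_upwards [eventually_mem_of_isOpen hU h0, hV.mem_nhds h0V] with P h1 h2 h
  exact hfF _ (h1 h) h2

/-- An isomorphism from the germ of the surface `x y = z ^ (n + 1)` to that of
`x y = z ^ (m + 1)` extends to a holomorphic map of the ambient spaces `ℂ³`. -/
theorem exists_extension_of_openPartialHomeomorph {n m : ℕ}
    {e : OpenPartialHomeomorph (ASurface n) (ASurface m)} (h0 : ASurface.origin n ∈ e.source)
    (he : ∀ V : Set (ASurface m), IsOpen V → V ⊆ e.target → ∀ f : ASurface m → ℂ,
      (HolASurface m V f ↔ HolASurface n (e.source ∩ e ⁻¹' V) (f ∘ e))) :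
    ∃ F : ℂ × ℂ × ℂ → ℂ × ℂ × ℂ, DifferentiableAt ℂ F 0 ∧
      ∀ᶠ P in 𝓝 (0 : ℂ × ℂ × ℂ), ∀ h : P.1 * P.2.1 = P.2.2 ^ (n + 1), (e ⟨P, h⟩).1 = F P := by
  have key : ∀ c : ℂ × ℂ × ℂ → ℂ, Differentiable ℂ c → ∃ F : ℂ × ℂ × ℂ → ℂ,
      DifferentiableAt ℂ F 0 ∧ ∀ᶠ P in 𝓝 (0 : ℂ × ℂ × ℂ),
        ∀ h : P.1 * P.2.1 = P.2.2 ^ (n + 1), c (e ⟨P, h⟩).1 = F P := fun c hc =>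
    exists_extension_of_holASurface (e.isOpen_inter_preimage e.open_target)
      ⟨h0, e.map_source h0⟩
      ((he _ e.open_target subset_rfl _).1 (holASurface_comp_val m e.target hc))
  obtain ⟨F₁, hF₁, h₁⟩ := key (fun P => P.1) (by fun_prop)
  obtain ⟨F₂, hF₂, h₂⟩ := key (fun P => P.2.1) (by fun_prop)
  obtain ⟨F₃, hF₃, h₃⟩ := key (fun P => P.2.2) (by fun_prop)
  refine ⟨fun P => (F₁ P, F₂ P, F₃ P), hF₁.prodMk (hF₂.prodMk hF₃), ?_⟩
  filter_upwards [h₁, h₂, h₃] with P h1 h2 h3 h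
  exact Prod.ext (h1 h) (Prod.ext (h2 h) (h3 h))

/-- The curve `t ↦ (t, c ^ (n + 1) t ^ n, c t)` on the surface `x y = z ^ (n + 1)`. -/
def curve (n : ℕ) (c t : ℂ) : ℂ × ℂ × ℂ := (t, c ^ (n + 1) * t ^ n, c * t)

theorem curve_mem (n : ℕ) (c t : ℂ) :
    (curve n c t).1 * (curve n c t).2.1 = (curve n c t).2.2 ^ (n + 1) := by
  simp only [curve]
  ring

theorem curve_zero {n : ℕ} (hn : n ≠ 0) (c : ℂ) : curve n c 0 = 0 := by
  simp [curve, hn]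

theorem hasDerivAt_curve (n : ℕ) (c : ℂ) :
    HasDerivAt (curve n c) (1, c ^ (n + 1) * (n * 0 ^ (n - 1)), c) 0 := by
  refine (hasDerivAt_id (0 : ℂ)).prodMk (((hasDerivAt_pow n (0 : ℂ)).const_mul _).prodMk ?_)
  simpa using (hasDerivAt_id (0 : ℂ)).const_mul c

theorem hasDerivAt_curve_of_two_le {n : ℕ} (hn : 2 ≤ n) (c : ℂ) :
    HasDerivAt (curve n c) (1, 0, c) 0 := by
  have h := hasDerivAt_curve n c
  rwa [zero_pow (by omega), mul_zero, mul_zero] at h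

/-- If a map is the identity on the surface, its differential at the origin fixes the tangent vectors
of curves on the surface. -/
theorem apply_eq_of_curve {n : ℕ} {H : ℂ × ℂ × ℂ → ℂ × ℂ × ℂ}
    {L : ℂ × ℂ × ℂ →L[ℂ] ℂ × ℂ × ℂ} (hH : HasFDerivAt H L 0)
    (hid : ∀ᶠ P in 𝓝 (0 : ℂ × ℂ × ℂ), P.1 * P.2.1 = P.2.2 ^ (n + 1) → H P = P)
    {γ : ℂ → ℂ × ℂ × ℂ} {w : ℂ × ℂ × ℂ} (hγ : HasDerivAt γ w 0) (hγ0 : γ 0 = 0)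
    (hγS : ∀ t, (γ t).1 * (γ t).2.1 = (γ t).2.2 ^ (n + 1)) : L w = w := by
  have h1 : HasDerivAt (H ∘ γ) (L w) 0 := by
    rw [← hγ0] at hH
    exact hH.comp_hasDerivAt 0 hγ
  have h2 : H ∘ γ =ᶠ[𝓝 0] γ := by
    have hc : Filter.Tendsto γ (𝓝 0) (𝓝 0) := by
      have := hγ.continuousAt.tendsto
      rwa [hγ0] at this
    filter_upwards [hc.eventually hid] with t ht using ht (hγS t)
  exact (h1.congr_of_eventuallyEq h2.symm).unique hγ

/-- The Zariski tangent space at the origin of `x y = z ^ (n + 1)`, `n ≥ 1`, is all of `ℂ³`: a map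
which is the identity on the surface has identity differential. -/
theorem eq_id_of_eqOn_aSurface {n : ℕ} (hn : n ≠ 0) {H : ℂ × ℂ × ℂ → ℂ × ℂ × ℂ}
    {L : ℂ × ℂ × ℂ →L[ℂ] ℂ × ℂ × ℂ} (hH : HasFDerivAt H L 0)
    (hid : ∀ᶠ P in 𝓝 (0 : ℂ × ℂ × ℂ), P.1 * P.2.1 = P.2.2 ^ (n + 1) → H P = P)
    (w : ℂ × ℂ × ℂ) : L w = w := by
  have h1 : L (1, 0, 0) = (1, 0, 0) := by
    have hd := hasDerivAt_curve n 0
    rw [zero_pow n.succ_ne_zero, zero_mul] at hd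
    exact apply_eq_of_curve hH hid hd (curve_zero hn 0) (curve_mem n 0)
  have h2 : L (0, 1, 0) = (0, 1, 0) := by
    refine apply_eq_of_curve hH hid (γ := fun t => (0, t, 0)) ?_ rfl fun t => by simp
    exact (hasDerivAt_const (0 : ℂ) (0 : ℂ)).prodMk
      ((hasDerivAt_id (0 : ℂ)).prodMk (hasDerivAt_const (0 : ℂ) (0 : ℂ)))
  have h3 := apply_eq_of_curve hH hid (hasDerivAt_curve n 1) (curve_zero hn 1) (curve_mem n 1)
  set s : ℂ := 1 ^ (n + 1) * (n * 0 ^ (n - 1))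
  have e3 : ((1, s, 1) : ℂ × ℂ × ℂ) = (1, 0, 0) + s • (0, 1, 0) + (0, 0, 1) := by simp
  have h4 : L (0, 0, 1) = (0, 0, 1) := by
    rw [e3, map_add, map_add, map_smul, h1, h2] at h3
    exact add_left_cancel h3
  have e : w = w.1 • ((1, 0, 0) : ℂ × ℂ × ℂ) + w.2.1 • ((0, 1, 0) : ℂ × ℂ × ℂ) +
      w.2.2 • ((0, 0, 1) : ℂ × ℂ × ℂ) := by
    simp
  rw [e, map_add, map_add, map_smul, map_smul, map_smul, h1, h2, h4]

/-- The germ of `x y = z ^ (n + 1)`, `n ≥ 1`, is not smooth: its tangent space has dimension 3. -/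
theorem not_germIso_holPlane {n : ℕ} (hn : n ≠ 0) :
    ¬ GermIso HolPlane (0, 0) (HolASurface n) (ASurface.origin n) := by
  rintro ⟨e, h0, he0, he⟩
  have hF : ∀ c : ℂ × ℂ × ℂ → ℂ, Differentiable ℂ c →
      DifferentiableAt ℂ (fun w => c (e w).1) (0, 0) := fun c hc =>
    ((he _ e.open_target subset_rfl _).1
      (holASurface_comp_val n e.target hc)).differentiableAt
      ((e.isOpen_inter_preimage e.open_target).mem_nhds ⟨h0, e.map_source h0⟩)
  have hF' : DifferentiableAt ℂ (fun w => (e w).1) (0, 0) :=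
    (hF (fun P => P.1) (by fun_prop)).prodMk
      ((hF (fun P => P.2.1) (by fun_prop)).prodMk (hF (fun P => P.2.2) (by fun_prop)))
  have h0t : ASurface.origin n ∈ e.target := he0 ▸ e.map_source h0
  have hG : ∀ c : ℂ × ℂ → ℂ, Differentiable ℂ c → ∃ G : ℂ × ℂ × ℂ → ℂ,
      DifferentiableAt ℂ G 0 ∧ ∀ᶠ P in 𝓝 (0 : ℂ × ℂ × ℂ),
        ∀ h : P.1 * P.2.1 = P.2.2 ^ (n + 1), c (e.symm ⟨P, h⟩) = G P := by
    intro c hc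
    refine exists_extension_of_holASurface e.open_target h0t (f := fun p => c (e.symm p)) ?_
    rw [he _ e.open_target subset_rfl]
    refine hc.differentiableOn.congr fun w hw => ?_
    simp [e.left_inv hw.1]
  obtain ⟨G₁, hG₁, h₁⟩ := hG (fun w => w.1) (by fun_prop)
  obtain ⟨G₂, hG₂, h₂⟩ := hG (fun w => w.2) (by fun_prop)
  have hGe : ∀ᶠ P in 𝓝 (0 : ℂ × ℂ × ℂ), ∀ h : P.1 * P.2.1 = P.2.2 ^ (n + 1),
      e.symm ⟨P, h⟩ = (G₁ P, G₂ P) := by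
    filter_upwards [h₁, h₂] with P h1 h2 h
    exact Prod.ext (h1 h) (h2 h)
  have hG0 : (G₁ 0, G₂ 0) = (0, 0) := by
    rw [← hGe.self_of_nhds (by simp), ← e.left_inv h0, he0]
    rfl
  have hcomp : HasFDerivAt (fun P => (e (G₁ P, G₂ P)).1)
      ((fderiv ℂ (fun w => (e w).1) (0, 0)).comp (fderiv ℂ (fun P => (G₁ P, G₂ P)) 0)) 0 := by
    have h1 := (hG₁.prodMk hG₂).hasFDerivAt
    have h2 := hF'.hasFDerivAt
    rw [← hG0] at h2 ⊢
    exact h2.comp 0 h1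
  have hid := eq_id_of_eqOn_aSurface hn hcomp (by
    filter_upwards [hGe, eventually_mem_of_isOpen e.open_target h0t] with P h1 h2 h
    rw [← h1 h, e.right_inv (h2 h)])
  have hsurj : Function.Surjective (fderiv ℂ (fun w => (e w).1) (0, 0)).toLinearMap :=
    fun w => ⟨_, hid w⟩
  have := LinearMap.finrank_le_finrank_of_surjective hsurj
  simp at this

/-- Comparison of the second-order terms at `0` in `a b = c ^ 2`. -/
theorem mul_eq_sq_of_hasDerivAt {a b c : ℂ → ℂ} {a' b' c' : ℂ} (ha : HasDerivAt a a' 0)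
    (hb : HasDerivAt b b' 0) (hc : HasDerivAt c c' 0) (ha0 : a 0 = 0) (hb0 : b 0 = 0)
    (hc0 : c 0 = 0) (h : ∀ᶠ t in 𝓝 0, a t * b t = c t ^ 2) : a' * b' = c' ^ 2 := by
  have h1 := (hasDerivAt_iff_tendsto_slope.1 ha).mul (hasDerivAt_iff_tendsto_slope.1 hb)
  have h2 := (hasDerivAt_iff_tendsto_slope.1 hc).pow 2
  refine tendsto_nhds_unique (h1.congr' ?_) h2
  filter_upwards [h.filter_mono nhdsWithin_le_nhds] with t ht
  simp only [slope_def_field, ha0, hb0, hc0, sub_zero, div_pow, ← ht]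
  ring

/-- The germs of `x y = z ^ (n + 1)`, `n ≥ 2`, and `x y = z ^ 2` are different: the tangent cone of
the former contains the plane `y = 0`, that of the latter is a smooth quadric cone and contains no
plane. -/
theorem not_germIso_aSurface_one {n : ℕ} (hn : 2 ≤ n) :
    ¬ GermIso (HolASurface n) (ASurface.origin n) (HolASurface 1) (ASurface.origin 1) := by
  intro hiso
  obtain ⟨e, h0, he0, he⟩ := hiso
  have h0t : ASurface.origin 1 ∈ e.target := he0 ▸ e.map_source h0
  have he' := hol_iff_symm (holASurface_congr n) he
  obtain ⟨F, hF, hFe⟩ := exists_extension_of_openPartialHomeomorph h0 he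
  obtain ⟨G, hG, hGe⟩ := exists_extension_of_openPartialHomeomorph (e := e.symm) h0t he'
  have hn0 : n ≠ 0 := by omega
  have hF0 : F 0 = 0 := by
    rw [← hFe.self_of_nhds (by simp)]
    exact congrArg Subtype.val he0
  have hF' := hF.hasFDerivAt
  set L := fderiv ℂ F 0
  set M := fderiv ℂ G 0
  have hML : ∀ w, M (L w) = w := by
    have hcomp : HasFDerivAt (G ∘ F) (M.comp L) 0 := by
      have hG' : HasFDerivAt G M (F 0) := by
        rw [hF0]
        exact hG.hasFDerivAt
      exact hG'.comp 0 hF'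
    have hFt : Filter.Tendsto F (𝓝 0) (𝓝 0) := by
      have := hF.continuousAt.tendsto
      rwa [hF0] at this
    refine eq_id_of_eqOn_aSurface hn0 hcomp ?_
    filter_upwards [hFe, hFt.eventually hGe, eventually_mem_of_isOpen e.open_source h0]
      with P h1 h2 h3 h
    have h4 : (F P).1 * (F P).2.1 = (F P).2.2 ^ (1 + 1) := h1 h ▸ (e ⟨P, h⟩).2
    have h5 : (⟨F P, h4⟩ : ASurface 1) = e ⟨P, h⟩ := Subtype.ext (h1 h).symm
    rw [Function.comp_apply, ← h2 h4, h5, e.left_inv (h3 h)]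
  -- the quadratic form `x y - z ^ 2` vanishes at the image of `(1, 0, c)` under `L`
  have hquad : ∀ c : ℂ, (L (1, 0, c)).1 * (L (1, 0, c)).2.1 = (L (1, 0, c)).2.2 ^ 2 := by
    intro c
    have hd := hasDerivAt_curve_of_two_le hn c
    have hd' : HasDerivAt (F ∘ curve n c) (L (1, 0, c)) 0 := by
      rw [← curve_zero hn0 c] at hF'
      exact hF'.comp_hasDerivAt 0 hd
    have hz : (F ∘ curve n c) 0 = 0 := by
      rw [Function.comp_apply, curve_zero hn0, hF0]
    have hct : Filter.Tendsto (curve n c) (𝓝 0) (𝓝 0) := by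
      have := hd.continuousAt.tendsto
      rwa [curve_zero hn0] at this
    refine mul_eq_sq_of_hasDerivAt hd'.fst hd'.snd.fst hd'.snd.snd (by rw [hz]; rfl)
      (by rw [hz]; rfl) (by rw [hz]; rfl) ?_
    filter_upwards [hct.eventually hFe] with t ht
    rw [Function.comp_apply, ← ht (curve_mem n c t)]
    exact (e ⟨curve n c t, curve_mem n c t⟩).2
  have hadd : ∀ c : ℂ, L (1, 0, c) = L (1, 0, 0) + c • L (0, 0, 1) := fun c => by
    rw [← map_smul, ← map_add]
    simp
  have hM1 := hML (1, 0, 0)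
  have hM3 := hML (0, 0, 1)
  have q0 := hquad 0
  have q1 := hquad 1
  have q2 := hquad (-1)
  rw [hadd] at q0 q1 q2
  obtain ⟨⟨a, b, c⟩, hv⟩ : ∃ v, L (1, 0, 0) = v := ⟨_, rfl⟩
  obtain ⟨⟨a', b', c'⟩, hv'⟩ : ∃ v, L (0, 0, 1) = v := ⟨_, rfl⟩
  rw [hv] at hM1
  rw [hv'] at hM3
  simp only [hv, hv', Prod.fst_add, Prod.snd_add, Prod.smul_fst, Prod.smul_snd, smul_eq_mul, zero_mul,
    add_zero, one_mul] at q0 q1 q2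
  have r3 : a' * b' = c' ^ 2 := by linear_combination (q1 + q2) / 2 - q0
  have rB : a * b' + a' * b = 2 * (c * c') := by linear_combination (q1 - q2) / 2
  -- an isotropic plane does not exist: the `2 × 2` minors of the two vectors vanish
  have m1 : a * b' - a' * b = 0 := by
    refine pow_eq_zero_iff two_ne_zero |>.1 ?_
    linear_combination (a * b' + a' * b + 2 * (c * c')) * rB - 4 * a' * b' * q0 - 4 * c ^ 2 * r3
  have m2 : a * c' - a' * c = 0 := by
    refine pow_eq_zero_iff two_ne_zero |>.1 ?_
    linear_combination -a ^ 2 * r3 - a' ^ 2 * q0 + a * a' * rB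
  have m3 : b * c' - b' * c = 0 := by
    refine pow_eq_zero_iff two_ne_zero |>.1 ?_
    linear_combination -b ^ 2 * r3 - b' ^ 2 * q0 + b * b' * rB
  have hdep : ∀ s s' : ℂ, s * a' = s' * a → s * b' = s' * b → s * c' = s' * c → s = 0 := by
    intro s s' h1 h2 h3
    have h : s • ((a', b', c') : ℂ × ℂ × ℂ) = s' • ((a, b, c) : ℂ × ℂ × ℂ) := by
      simp [h1, h2, h3]
    have h' := congrArg M h
    rw [map_smul, map_smul, hM1, hM3] at h'
    simpa using congrArg (fun w : ℂ × ℂ × ℂ => w.2.2) h'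
  have ha : a = 0 := hdep a a' (by ring) (by linear_combination m1) (by linear_combination m2)
  have hb : b = 0 := hdep b b' (by linear_combination -m1) (by ring) (by linear_combination m3)
  have hc : c = 0 := hdep c c' (by linear_combination -m2) (by linear_combination -m3) (by ring)
  rw [ha, hb, hc] at hM1
  have h0M : M (0, 0, 0) = 0 := map_zero M
  rw [h0M] at hM1
  simpa using congrArg Prod.fst hM1

/-! ### The lattice and the group -/

/-- The squared norm of a Hurwitz quaternion is an integer, so nonzero ones have norm at least `1`. -/
theorem eq_zero_of_mem_hurwitz {x : ℍ[ℝ]} (hx : x ∈ hurwitz) (h1 : ‖x‖ < 1) : x = 0 := by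
  obtain ⟨a, b, c, d, rfl⟩ := hx
  set x := (a : ℝ) • (1 : ℍ[ℝ]) + (b : ℝ) • quat 0 1 0 0
    + (c : ℝ) • quat 0 0 1 0 + (d : ℝ) • quat (1 / 2) (1 / 2) (1 / 2) (1 / 2) with hx
  have hn : ‖x‖ * ‖x‖ =
      ((a ^ 2 + b ^ 2 + c ^ 2 + d ^ 2 + a * d + b * d + c * d : ℤ) : ℝ) := by
    rw [← Quaternion.normSq_eq_norm_mul_self, Quaternion.normSq_def']
    simp [hx]
    ring
  have hlt : ((a ^ 2 + b ^ 2 + c ^ 2 + d ^ 2 + a * d + b * d + c * d : ℤ) : ℝ) < (1 : ℤ) := by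
    rw [← hn]
    push_cast
    nlinarith [norm_nonneg x]
  have hle : a ^ 2 + b ^ 2 + c ^ 2 + d ^ 2 + a * d + b * d + c * d ≤ 0 := by
    have := Int.cast_lt.1 hlt
    omega
  have h0 : ‖x‖ * ‖x‖ ≤ 0 := by
    rw [hn]
    exact_mod_cast hle
  exact norm_eq_zero.1 (mul_self_eq_zero.1 (le_antisymm h0 (mul_self_nonneg _)))

theorem toTorus_add (x y : ℍ[ℝ]) : toTorus (x + y) = toTorus x + toTorus y := rfl

theorem toTorus_sub (x y : ℍ[ℝ]) : toTorus (x - y) = toTorus x - toTorus y := rfl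

theorem toTorus_eq_zero_iff {x : ℍ[ℝ]} : toTorus x = 0 ↔ x ∈ hurwitz :=
  QuotientAddGroup.eq_zero_iff x

theorem eq_of_toTorus_eq {x y : ℍ[ℝ]} (h : toTorus x = toTorus y) (h1 : ‖y - x‖ < 1) : x = y := by
  rw [toTorus_eq_iff, neg_add_eq_sub] at h
  exact (sub_eq_zero.1 (eq_zero_of_mem_hurwitz h h1)).symm

/-- A nonzero point of the torus has no representatives near zero. -/
theorem eventually_toTorus_ne {d : Torus} (hd : d ≠ 0) : ∀ᶠ y in 𝓝 (0 : ℍ[ℝ]), toTorus y ≠ d := by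
  by_cases h : ∃ y, ‖y‖ < 1 / 2 ∧ toTorus y = d
  · obtain ⟨y, hy, rfl⟩ := h
    have hy0 : 0 < ‖y‖ := by
      rw [norm_pos_iff]
      rintro rfl
      exact hd rfl
    filter_upwards [Metric.ball_mem_nhds (0 : ℍ[ℝ]) hy0] with z hz hzy
    rw [mem_ball_zero_iff] at hz
    have : z = y := eq_of_toTorus_eq hzy (by
      calc ‖y - z‖ ≤ ‖y‖ + ‖z‖ := norm_sub_le _ _
        _ < 1 := by linarith)
    rw [this] at hz
    exact lt_irrefl _ hz
  · push Not at h
    filter_upwards [Metric.ball_mem_nhds (0 : ℍ[ℝ]) (half_pos one_pos)] with z hz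
    exact h z (by simpa using hz)

theorem affine_apply (l : hurwitzˣ) (r x : Torus) : affine l r x = leftMul l x + r := rfl

theorem affine_add (l : hurwitzˣ) (r x y : Torus) :
    affine l r (x + y) = affine l r x + leftMul l y := by
  simp only [affine_apply, map_add]
  abel

/-- The pairs `(l, r)` with `(l; r)` in the group. -/
def affinePairs : Set (hurwitzˣ × Torus) :=
  {(1, 0), (-1, 0), (unitI, 0), (-unitI, 0), (unitJ, alpha), (-unitJ, alpha), (unitK, alpha),
    (-unitK, alpha)}

theorem affine_neg (l : hurwitzˣ) (r : Torus) (hr : -r = r) :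
    affine (-l) r = autNeg * affine l r := by
  rw [autNeg, affine_mul, leftMul_neg_one, hr, add_zero, neg_one_mul]

theorem mem_hatQ8_iff {g : Equiv.Perm Torus} :
    g ∈ hatQ8 ↔ ∃ p ∈ affinePairs, g = affine p.1 p.2 := by
  have h : g ∈ hatQ8 ↔ g = 1 ∨ g = autNeg ∨ g = autI ∨ g = autNeg * autI ∨ g = autJ ∨
    g = autNeg * autJ ∨ g = autK ∨ g = autNeg * autK := Iff.rfl
  rw [h]
  simp only [affinePairs, Set.mem_insert_iff, Set.mem_singleton_iff, exists_eq_or_imp,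
    exists_eq_left, affine_one, affine_neg _ _ neg_zero, affine_neg _ _ neg_alpha]
  simp only [autI, autJ, autK, autNeg, mul_one]

theorem norm_quat_eq_one {a b c d : ℝ} (h : a ^ 2 + b ^ 2 + c ^ 2 + d ^ 2 = 1) :
    ‖quat a b c d‖ = 1 := by
  have h1 : ‖quat a b c d‖ * ‖quat a b c d‖ = 1 := by
    rw [← Quaternion.normSq_eq_norm_mul_self, Quaternion.normSq_def']
    simpa using h
  nlinarith [norm_nonneg (quat a b c d)]

theorem norm_of_mem_affinePairs {p : hurwitzˣ × Torus} (hp : p ∈ affinePairs) :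
    ‖((p.1 : hurwitz) : ℍ[ℝ])‖ = 1 := by
  have hI : ‖((unitI : hurwitz) : ℍ[ℝ])‖ = 1 := norm_quat_eq_one (by norm_num)
  have hJ : ‖((unitJ : hurwitz) : ℍ[ℝ])‖ = 1 := norm_quat_eq_one (by norm_num)
  have hK : ‖((unitK : hurwitz) : ℍ[ℝ])‖ = 1 := norm_quat_eq_one (by norm_num)
  simp only [affinePairs, Set.mem_insert_iff, Set.mem_singleton_iff] at hp
  rcases hp with rfl | rfl | rfl | rfl | rfl | rfl | rfl | rfl <;> simp [hI, hJ, hK]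

/-! ### The quotient map and its local structure -/

/-- The projection from the quaternions to the quotient surface. -/
def proj (x : ℍ[ℝ]) : QuotientSurface := toQuotient (toTorus x)

theorem toQuotient_eq_iff {x y : Torus} :
    toQuotient x = toQuotient y ↔ ∃ p ∈ affinePairs, affine p.1 p.2 x = y := by
  rw [eq_comm, toQuotient, toQuotient, Quotient.eq]
  constructor
  · rintro ⟨g, hg⟩
    obtain ⟨p, hp, hgp⟩ := mem_hatQ8_iff.1 g.2
    refine ⟨p, hp, ?_⟩
    rw [← hgp]
    exact hg
  · rintro ⟨p, hp, hxy⟩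
    exact ⟨⟨affine p.1 p.2, mem_hatQ8_iff.2 ⟨p, hp, rfl⟩⟩, hxy⟩

theorem continuous_toTorus : Continuous toTorus := continuous_quot_mk

theorem continuous_affine (l : hurwitzˣ) (r : Torus) : Continuous (affine l r) := by
  have h : Continuous (leftMul l) := by
    refine continuous_quot_lift _ ?_
    exact continuous_toTorus.comp (continuous_const.mul continuous_id)
  exact h.add continuous_const

theorem continuous_proj : Continuous proj := continuous_quot_mk.comp continuous_quot_mk

theorem isOpenMap_proj : IsOpenMap proj := by
  have : ContinuousConstSMul hatQ8 Torus := ⟨fun g => by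
    obtain ⟨p, -, hgp⟩ := mem_hatQ8_iff.1 g.2
    have h : (fun x : Torus => g • x) = affine p.1 p.2 := by
      rw [← hgp]
      rfl
    rw [h]
    exact continuous_affine _ _⟩
  exact (isOpenMap_quotient_mk'_mul (Γ := hatQ8) (T := Torus)).comp
    QuotientAddGroup.isOpenMap_coe

/-- Two quaternions have the same image in the quotient surface only if they are related by an
affine map which preserves the projection. -/
theorem exists_affine_of_proj_eq {x y : ℍ[ℝ]} (h : proj x = proj y) :
    ∃ a b : ℍ[ℝ], y = a * x + b ∧ ∀ z, proj (a * z + b) = proj z := by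
  obtain ⟨⟨l, r⟩, hp, hxy⟩ := toQuotient_eq_iff.1 h
  obtain ⟨b, rfl⟩ := QuotientAddGroup.mk_surjective r
  refine ⟨(l : hurwitz), y - (l : hurwitz) * x, by abel, fun z => ?_⟩
  refine (toQuotient_eq_iff.2 ⟨_, hp, ?_⟩).symm
  have h1 : toTorus y = toTorus ((l : hurwitz) * x) + toTorus b := hxy.symm
  have h2 : toTorus ((l : hurwitz) * z + (y - (l : hurwitz) * x)) =
      toTorus ((l : hurwitz) * z) + (toTorus y - toTorus ((l : hurwitz) * x)) := rfl
  rw [h2, h1, add_sub_cancel_left]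
  rfl

/-- The linear parts of the elements of the group which fix the class of `x`. -/
def linearStabilizer (x : ℍ[ℝ]) : Set ℍ[ℝ] :=
  {a | ∃ p ∈ affinePairs, affine p.1 p.2 (toTorus x) = toTorus x ∧ a = (p.1 : hurwitz)}

theorem norm_of_mem_linearStabilizer {x a : ℍ[ℝ]} (ha : a ∈ linearStabilizer x) : ‖a‖ = 1 := by
  obtain ⟨p, hp, -, rfl⟩ := ha
  exact norm_of_mem_affinePairs hp

/-- Near `x` the fibres of the projection are the orbits of the stabilizer of the class of `x`. -/
theorem exists_ball_proj_eq_iff (x : ℍ[ℝ]) : ∃ ε > 0, ∀ h ∈ Metric.ball (0 : ℍ[ℝ]) ε,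
    ∀ h' ∈ Metric.ball (0 : ℍ[ℝ]) ε,
      (proj (x + h) = proj (x + h') ↔ ∃ a ∈ linearStabilizer x, h' = a * h) := by
  have hfin : affinePairs.Finite := by
    simp [affinePairs]
  have hev : ∀ᶠ y in 𝓝 (0 : ℍ[ℝ]), ∀ p ∈ affinePairs,
      affine p.1 p.2 (toTorus x) ≠ toTorus x →
        toTorus y ≠ toTorus x - affine p.1 p.2 (toTorus x) := by
    rw [Filter.eventually_all_finite hfin]
    intro p _
    by_cases hp : affine p.1 p.2 (toTorus x) = toTorus x
    · exact Filter.Eventually.of_forall fun y h => absurd hp h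
    · filter_upwards [eventually_toTorus_ne (sub_ne_zero.2 (Ne.symm hp))] with y hy _ using hy
  obtain ⟨δ, hδ, hball⟩ := Metric.eventually_nhds_iff.1 hev
  refine ⟨min δ 1 / 2, by positivity, fun h hh h' hh' => ?_⟩
  rw [mem_ball_zero_iff] at hh hh'
  constructor
  · intro heq
    obtain ⟨p, hp, hxy⟩ := toQuotient_eq_iff.1 heq
    rw [toTorus_add, toTorus_add, affine_add, leftMul_toTorus] at hxy
    have hnorm : ‖((p.1 : hurwitz) : ℍ[ℝ]) * h - h'‖ < min δ 1 := by
      calc ‖((p.1 : hurwitz) : ℍ[ℝ]) * h - h'‖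
          ≤ ‖((p.1 : hurwitz) : ℍ[ℝ]) * h‖ + ‖h'‖ := norm_sub_le _ _
        _ = ‖h‖ + ‖h'‖ := by rw [norm_mul, norm_of_mem_affinePairs hp, one_mul]
        _ < min δ 1 := by linarith
    have hfix : affine p.1 p.2 (toTorus x) = toTorus x := by
      by_contra hne
      refine hball (y := ((p.1 : hurwitz) : ℍ[ℝ]) * h - h') ?_ p hp hne ?_
      · rw [dist_zero_right]
        exact hnorm.trans_le (min_le_left _ _)
      · rw [toTorus_sub, sub_eq_sub_iff_add_eq_add, add_comm, hxy]
    refine ⟨_, ⟨p, hp, hfix, rfl⟩, ?_⟩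
    rw [hfix] at hxy
    exact eq_of_toTorus_eq (add_left_cancel hxy).symm (hnorm.trans_le (min_le_right _ _))
  · rintro ⟨_, ⟨p, hp, hfix, rfl⟩, rfl⟩
    refine toQuotient_eq_iff.2 ⟨p, hp, ?_⟩
    rw [toTorus_add, affine_add, hfix, leftMul_toTorus, toTorus_add]

/-- Two open continuous maps with the same fibres over an open set induce a homeomorphism between
the images of this set. -/
theorem exists_openPartialHomeomorph {A X Y : Type*} [TopologicalSpace A] [TopologicalSpace X]
    [TopologicalSpace Y] [Nonempty A] {B : Set A} (hB : IsOpen B) {φ : A → X} {ψ : A → Y}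
    (hφ : Continuous φ) (hφo : IsOpenMap φ) (hψ : Continuous ψ) (hψo : IsOpenMap ψ)
    (hfib : ∀ a ∈ B, ∀ b ∈ B, (φ a = φ b ↔ ψ a = ψ b)) :
    ∃ e : OpenPartialHomeomorph X Y, e.source = φ '' B ∧ e.target = ψ '' B ∧
      ∀ a ∈ B, e (φ a) = ψ a := by
  have h1 : ∀ a ∈ B, ψ (Function.invFunOn φ B (φ a)) = ψ a := fun a ha =>
    (hfib _ (Function.invFunOn_pos ⟨a, ha, rfl⟩).1 _ ha).1 (Function.invFunOn_pos ⟨a, ha, rfl⟩).2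
  have h2 : ∀ a ∈ B, φ (Function.invFunOn ψ B (ψ a)) = φ a := fun a ha =>
    (hfib _ (Function.invFunOn_pos ⟨a, ha, rfl⟩).1 _ ha).2 (Function.invFunOn_pos ⟨a, ha, rfl⟩).2
  refine ⟨{ toFun := fun x => ψ (Function.invFunOn φ B x)
            invFun := fun y => φ (Function.invFunOn ψ B y)
            source := φ '' B
            target := ψ '' B
            map_source' := ?_
            map_target' := ?_
            left_inv' := ?_
            right_inv' := ?_
            open_source := hφo _ hB
            open_target := hψo _ hB
            continuousOn_toFun := ?_
            continuousOn_invFun := ?_ }, rfl, rfl, h1⟩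
  · rintro _ ⟨a, ha, rfl⟩
    exact ⟨a, ha, (h1 a ha).symm⟩
  · rintro _ ⟨a, ha, rfl⟩
    exact ⟨a, ha, (h2 a ha).symm⟩
  · rintro _ ⟨a, ha, rfl⟩
    simp only [h1 a ha, h2 a ha]
  · rintro _ ⟨a, ha, rfl⟩
    simp only [h1 a ha, h2 a ha]
  · rw [continuousOn_open_iff (hφo _ hB)]
    intro V hV
    convert hφo _ (hB.inter (hV.preimage hψ)) using 1
    ext x
    constructor
    · rintro ⟨⟨a, ha, rfl⟩, hx⟩
      rw [Set.mem_preimage, h1 a ha] at hx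
      exact ⟨a, ⟨ha, hx⟩, rfl⟩
    · rintro ⟨a, ⟨ha, hx⟩, rfl⟩
      refine ⟨⟨a, ha, rfl⟩, ?_⟩
      rwa [Set.mem_preimage, h1 a ha]
  · rw [continuousOn_open_iff (hψo _ hB)]
    intro V hV
    convert hψo _ (hB.inter (hV.preimage hφ)) using 1
    ext x
    constructor
    · rintro ⟨⟨a, ha, rfl⟩, hx⟩
      rw [Set.mem_preimage, h2 a ha] at hx
      exact ⟨a, ⟨ha, hx⟩, rfl⟩
    · rintro ⟨a, ⟨ha, hx⟩, rfl⟩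
      refine ⟨⟨a, ha, rfl⟩, ?_⟩
      rwa [Set.mem_preimage, h2 a ha]

/-- Holomorphy is preserved by `y ↦ a y + b`: left multiplication commutes with the complex
structure, which is a right multiplication. -/
theorem exists_hasFDerivAt_comp_affine {q a b x : ℍ[ℝ]} {f : ℍ[ℝ] → ℂ}
    (h : ∃ L : ℍ[ℝ] →L[ℝ] ℂ, HasFDerivAt f L (a * x + b) ∧ ∀ v, L (v * q) = Complex.I * L v) :
    ∃ L : ℍ[ℝ] →L[ℝ] ℂ, HasFDerivAt (fun y => f (a * y + b)) L x ∧
      ∀ v, L (v * q) = Complex.I * L v := by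
  obtain ⟨L, hL, hLq⟩ := h
  refine ⟨L.comp (ContinuousLinearMap.mul ℝ ℍ[ℝ] a), ?_, fun v => ?_⟩
  · have h1 : HasFDerivAt (fun y : ℍ[ℝ] => a * y + b) (ContinuousLinearMap.mul ℝ ℍ[ℝ] a) x :=
      ((ContinuousLinearMap.mul ℝ ℍ[ℝ] a).hasFDerivAt).add_const b
    exact hL.comp x h1
  · simp only [ContinuousLinearMap.comp_apply, ContinuousLinearMap.mul_apply']
    rw [← mul_assoc, hLq]

/-- The germ of the quotient surface at the image of `x` is the germ of any space which is the
quotient of the quaternions by the linear stabilizer of `x`. -/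
theorem germIso_of_linear_quotient {Y : Type} [TopologicalSpace Y]
    {HY : Set Y → (Y → ℂ) → Prop} {q x : ℍ[ℝ]} {ψ : ℍ[ℝ] → Y}
    (hψ : Continuous ψ) (hψo : IsOpenMap ψ)
    (hfib : ∀ h h', ψ h = ψ h' ↔ ∃ a ∈ linearStabilizer x, h' = a * h)
    (hHol : ∀ V : Set Y, IsOpen V → ∀ f : Y → ℂ,
      (HY V f ↔ HolQuaternion q (ψ ⁻¹' V) (f ∘ ψ))) :
    GermIso (HolQuotient q) (proj x) HY (ψ 0) := by
  obtain ⟨ε, hε, hball⟩ := exists_ball_proj_eq_iff x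
  set B := Metric.ball (0 : ℍ[ℝ]) ε
  have hφ : Continuous fun h => proj (x + h) :=
    continuous_proj.comp (continuous_const.add continuous_id)
  have hφo : IsOpenMap fun h => proj (x + h) := isOpenMap_proj.comp (isOpenMap_add_left x)
  obtain ⟨e, hes, het, he⟩ := exists_openPartialHomeomorph (B := B) Metric.isOpen_ball hφ hφo
    hψ hψo fun h hh h' hh' => (hball h hh h' hh').trans (hfib h h').symm
  have h0 : (0 : ℍ[ℝ]) ∈ B := Metric.mem_ball_self hε
  -- linear parts are isometries, so the ball is saturated for `ψ`
  have hsat : ∀ h, ψ h ∈ ψ '' B → h ∈ B := by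
    rintro h ⟨h', hh', heq⟩
    obtain ⟨a, ha, rfl⟩ := (hfib _ _).1 heq
    rw [mem_ball_zero_iff, norm_mul, norm_of_mem_linearStabilizer ha, one_mul]
    exact mem_ball_zero_iff.1 hh'
  have hx : proj (x + 0) = proj x := by rw [add_zero]
  refine ⟨e, ?_, ?_, fun V hV hVt f => ?_⟩
  · rw [hes]
    exact ⟨0, h0, hx⟩
  · rw [← hx]
    exact he 0 h0
  rw [hHol V hV]
  rw [het] at hVt
  have hnear : ∀ h ∈ ψ ⁻¹' V, (f ∘ ψ) =ᶠ[𝓝 h] fun h' => f (e (proj (x + h'))) := by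
    intro h hh
    filter_upwards [Metric.isOpen_ball.mem_nhds (hsat h (hVt hh))] with h' hh'
    rw [he h' hh', Function.comp_apply]
  constructor
  -- the saturated preimage contains more than the ball around `x`: move its points into the ball
  · rintro H y ⟨hy, hyV⟩
    rw [hes] at hy
    obtain ⟨h, hh, hhy⟩ := hy
    obtain ⟨a, b, hab, hinv⟩ := exists_affine_of_proj_eq (x := y) (y := x + h) hhy.symm
    have hhV : h ∈ ψ ⁻¹' V := by
      rw [Set.mem_preimage, ← he h hh]
      have : e (proj (x + h)) = e (toQuotient (toTorus y)) := congrArg e hhy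
      rw [this]
      exact hyV
    obtain ⟨L, hL, hLq⟩ := H h hhV
    have hL' := hL.congr_of_eventuallyEq (hnear h hhV).symm
    have hpt : a * y + (b - x) = h := by
      rw [← add_sub_assoc, ← hab]
      abel
    rw [← hpt] at hL'
    obtain ⟨L', hL'', hL'q⟩ := exists_hasFDerivAt_comp_affine ⟨L, hL', hLq⟩
    refine ⟨L', ?_, hL'q⟩
    convert hL'' using 1
    ext z
    have hz : x + (a * z + (b - x)) = a * z + b := by abel
    rw [hz, hinv z]
    rfl
  · intro H h hh
    have hhB := hsat h (hVt hh)
    have hmem : toQuotient (toTorus (1 * h + x)) ∈ e.source ∩ e ⁻¹' V := by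
      have hp : toQuotient (toTorus (1 * h + x)) = proj (x + h) := by
        rw [one_mul, add_comm]
        rfl
      rw [hp]
      refine ⟨?_, ?_⟩
      · rw [hes]
        exact ⟨h, hhB, rfl⟩
      · rw [Set.mem_preimage, he h hhB]
        exact hh
    obtain ⟨L, hL, hLq⟩ := exists_hasFDerivAt_comp_affine (H (1 * h + x) hmem)
    refine ⟨L, ?_, hLq⟩
    refine HasFDerivAt.congr_of_eventuallyEq ?_ (hnear h hh)
    convert hL using 1
    ext z
    rw [one_mul, add_comm x z]
    rfl

/-! ### Complex coordinates -/

/-- Two square roots of `-1` in the quaternions are conjugate. -/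
theorem exists_mul_eq_mul {a b : ℍ[ℝ]} (ha : a * a = -1) (hb : b * b = -1) :
    ∃ w, w ≠ 0 ∧ a * w = w * b := by
  -- `w = x - a x b` intertwines for every `x`; if it always vanishes, `a` is central
  by_contra hno
  push Not at hno
  have h0 : ∀ x : ℍ[ℝ], x = a * x * b := by
    intro x
    by_contra hx
    refine hno (x - a * x * b) (sub_ne_zero.2 hx) ?_
    rw [mul_sub, sub_mul, mul_assoc (a * x) b b, hb, ← mul_assoc a (a * x) b, ← mul_assoc a a x, ha]
    simp only [neg_mul, one_mul, mul_neg, mul_one]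
    abel
  have h1 : ∀ x : ℍ[ℝ], a * x = -(x * b) := by
    intro x
    conv_lhs => rw [h0 x, ← mul_assoc, ← mul_assoc, ha]
    simp
  have h2 : ∀ x : ℍ[ℝ], a * x = x * a := by
    intro x
    have h3 : a = -b := by simpa using h1 1
    rw [h1 x, h3, mul_neg]
  have hi := h2 (quat 0 1 0 0)
  have hj := h2 (quat 0 0 1 0)
  have e1 := congrArg QuaternionAlgebra.imJ hi
  have e2 := congrArg QuaternionAlgebra.imK hi
  have e3 := congrArg QuaternionAlgebra.imK hj
  have e4 := congrArg QuaternionAlgebra.re ha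
  simp at e1 e2 e3 e4
  have f1 : a.imI = 0 := by linarith
  have f2 : a.imJ = 0 := by linarith
  have f3 : a.imK = 0 := by linarith
  simp only [f1, f2, f3] at e4
  nlinarith [mul_self_nonneg a.re]

/-- For `a² = q² = -1` there are complex coordinates `(u, v)` on the quaternions for the complex
structure given by right multiplication by `q`, in which left multiplication by `a` is
`(u, v) ↦ (√-1 u, -√-1 v)`. After conjugation, `a = q = i` and
`(u, v) = (x₀ + √-1 x₁, x₂ - √-1 x₃)`. -/
theorem exists_coordinates {a q : ℍ[ℝ]} (ha : a * a = -1) (hq : q * q = -1) :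
    ∃ T : ℍ[ℝ] ≃L[ℝ] ℂ × ℂ, (∀ h, T (h * q) = Complex.I • T h) ∧
      ∀ h, T (a * h) = (Complex.I * (T h).1, -Complex.I * (T h).2) := by
  have hi : quat 0 1 0 0 * quat 0 1 0 0 = -1 := by ext <;> simp
  obtain ⟨p, hp0, hp⟩ := exists_mul_eq_mul ha hi
  obtain ⟨w, hw0, hw⟩ := exists_mul_eq_mul hq hi
  let T : ℍ[ℝ] ≃ₗ[ℝ] ℂ × ℂ :=
    { toFun := fun x => (⟨(p⁻¹ * x * w).re, (p⁻¹ * x * w).imI⟩,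
        ⟨(p⁻¹ * x * w).imJ, -(p⁻¹ * x * w).imK⟩)
      invFun := fun z => p * quat z.1.re z.1.im z.2.re (-z.2.im) * w⁻¹
      map_add' := fun x y => by
        simp only [mul_add, add_mul]
        refine Prod.ext (Complex.ext ?_ ?_) (Complex.ext ?_ ?_) <;> simp
        ring
      map_smul' := fun c x => by
        simp only [mul_smul_comm, smul_mul_assoc]
        refine Prod.ext (Complex.ext ?_ ?_) (Complex.ext ?_ ?_) <;> simp
        ring
      left_inv := fun x => by
        have h : quat (p⁻¹ * x * w).re (p⁻¹ * x * w).imI (p⁻¹ * x * w).imJ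
            (-(-(p⁻¹ * x * w).imK)) = p⁻¹ * x * w := by
          rw [neg_neg]
          rfl
        simp only [h]
        rw [mul_assoc p⁻¹, mul_inv_cancel_left₀ hp0, mul_inv_cancel_right₀ hw0]
      right_inv := fun z => by
        have h : p⁻¹ * (p * quat z.1.re z.1.im z.2.re (-z.2.im) * w⁻¹) * w =
            quat z.1.re z.1.im z.2.re (-z.2.im) := by
          rw [mul_assoc p, inv_mul_cancel_left₀ hp0, inv_mul_cancel_right₀ hw0]
        simp only [h]
        simp }
  refine ⟨T.toContinuousLinearEquiv, fun h => ?_, fun h => ?_⟩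
  · have h1 : p⁻¹ * (h * q) * w = (p⁻¹ * h * w) * quat 0 1 0 0 := by
      rw [← mul_assoc, mul_assoc _ q w, hw, ← mul_assoc]
    show T (h * q) = Complex.I • T h
    simp only [T, LinearEquiv.coe_mk, LinearMap.coe_mk, AddHom.coe_mk, h1]
    refine Prod.ext (Complex.ext ?_ ?_) (Complex.ext ?_ ?_) <;> simp
  · have h1 : p⁻¹ * (a * h) * w = quat 0 1 0 0 * (p⁻¹ * h * w) := by
      have h2 : p⁻¹ * a = quat 0 1 0 0 * p⁻¹ := by
        rw [inv_mul_eq_iff_eq_mul₀ hp0, ← mul_assoc, ← hp, mul_inv_cancel_right₀ hp0]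
      rw [← mul_assoc, h2, mul_assoc, mul_assoc, mul_assoc]
    show T (a * h) = (Complex.I * (T h).1, -Complex.I * (T h).2)
    simp only [T, LinearEquiv.coe_mk, LinearMap.coe_mk, AddHom.coe_mk, h1]
    refine Prod.ext (Complex.ext ?_ ?_) (Complex.ext ?_ ?_) <;> simp

/-- In complex coordinates, holomorphy on the quaternions is complex differentiability. -/
theorem holQuaternion_comp_iff {q : ℍ[ℝ]} (T : ℍ[ℝ] ≃L[ℝ] ℂ × ℂ)
    (hT : ∀ h, T (h * q) = Complex.I • T h) {W : Set (ℂ × ℂ)} (hW : IsOpen W) (F : ℂ × ℂ → ℂ) :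
    HolQuaternion q (T ⁻¹' W) (F ∘ T) ↔ DifferentiableOn ℂ F W := by
  constructor
  · intro H w hw
    obtain ⟨L, hL, hLq⟩ := H (T.symm w) (by simpa using hw)
    have h1 : HasFDerivAt F (L.comp (T.symm : ℂ × ℂ →L[ℝ] ℍ[ℝ])) w := by
      have h2 : HasFDerivAt ((F ∘ T) ∘ T.symm) (L.comp (T.symm : ℂ × ℂ →L[ℝ] ℍ[ℝ])) w :=
        hL.comp w T.symm.hasFDerivAt
      have h3 : (F ∘ T) ∘ T.symm = F := by
        ext z
        simp
      rwa [h3] at h2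
    have hI : ∀ z : ℂ × ℂ, L (T.symm (Complex.I • z)) = Complex.I * L (T.symm z) := by
      intro z
      rw [← hLq]
      congr 1
      rw [T.symm_apply_eq, hT, T.apply_symm_apply]
    let L' : ℂ × ℂ →L[ℂ] ℂ :=
      { toFun := fun z => L (T.symm z)
        map_add' := fun z z' => by simp
        map_smul' := fun c z => by
          have hc : c • z = (c.re : ℝ) • z + (c.im : ℝ) • (Complex.I • z) := by
            conv_lhs => rw [← Complex.re_add_im c, add_smul, mul_smul]
            rfl
          rw [hc, map_add, map_add, map_smul, map_smul, map_smul, map_smul, hI]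
          simp only [RingHom.id_apply, smul_eq_mul, Complex.real_smul]
          conv_rhs => rw [← Complex.re_add_im c]
          ring
        cont := L.continuous.comp T.symm.continuous }
    have h3 : HasFDerivAt F L' w := hasFDerivAt_of_restrictScalars ℝ h1 rfl
    exact h3.differentiableAt.differentiableWithinAt
  · intro H h hh
    have h1 := (H.differentiableAt (hW.mem_nhds hh)).hasFDerivAt
    refine ⟨((fderiv ℂ F (T h)).restrictScalars ℝ).comp (T : ℍ[ℝ] →L[ℝ] ℂ × ℂ), ?_, fun v => ?_⟩
    · exact (h1.restrictScalars ℝ).comp h T.hasFDerivAt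
    · simp [hT]

/-! ### The three local types of the quotient surface -/

theorem isSmoothPoint_of_linearStabilizer {q x : ℍ[ℝ]} (hq : q * q = -1)
    (hx : linearStabilizer x = {1}) : IsSmoothPoint q (proj x) := by
  obtain ⟨T, hT, -⟩ := exists_coordinates hq hq
  have h0 : T 0 = (0, 0) := map_zero T
  rw [IsSmoothPoint, ← h0]
  refine germIso_of_linear_quotient T.continuous T.toHomeomorph.isOpenMap (fun h h' => ?_)
    fun V hV f => (holQuaternion_comp_iff T hT hV f).symm
  rw [hx, T.injective.eq_iff]
  simp [eq_comm]

/-- If the stabilizer of `x` acts in suitable complex coordinates as the group of `(n + 1)`-st roots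
of unity with weights `(1, -1)`, the image of `x` is a singularity of type `A_n`. -/
theorem isSingularityA_of_coordinates {q x : ℍ[ℝ]} {n : ℕ} (T : ℍ[ℝ] ≃L[ℝ] ℂ × ℂ)
    (hT : ∀ h, T (h * q) = Complex.I • T h)
    (hfib : ∀ h h', (∃ ζ : ℂ, ζ ^ (n + 1) = 1 ∧ T h' = (ζ * (T h).1, ζ⁻¹ * (T h).2)) ↔
      ∃ a ∈ linearStabilizer x, h' = a * h) : IsSingularityA q n (proj x) := by
  have h0 : cyclicQuotient n (T 0) = ASurface.origin n := by rw [map_zero, cyclicQuotient_zero]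
  rw [IsSingularityA, ← h0]
  refine germIso_of_linear_quotient (ψ := cyclicQuotient n ∘ T)
    ((continuous_cyclicQuotient n).comp T.continuous)
    ((isOpenMap_cyclicQuotient n).comp T.toHomeomorph.isOpenMap)
    (fun h h' => (cyclicQuotient_eq_iff n).trans (hfib h h')) fun V hV f => ?_
  rw [holASurface_iff n hV, ← holQuaternion_comp_iff T hT (hV.preimage (continuous_cyclicQuotient n))]
  rfl

theorem isSingularityA_one_of_linearStabilizer {q x : ℍ[ℝ]} (hq : q * q = -1)
    (hx : linearStabilizer x = {1, -1}) : IsSingularityA q 1 (proj x) := by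
  obtain ⟨T, hT, -⟩ := exists_coordinates hq hq
  refine isSingularityA_of_coordinates T hT fun h h' => ?_
  have hζ : ∀ ζ : ℂ, ζ ^ (1 + 1) = 1 ↔ ζ = 1 ∨ ζ = -1 := fun ζ => by
    rw [← sq_eq_sq_iff_eq_or_eq_neg, one_pow]
  have h1 : ((T h).1, (T h).2) = T h := rfl
  have h2 : (-(T h).1, -(T h).2) = T (-h) := by rw [map_neg]; rfl
  have h5 : ∀ y, T h' = -T y ↔ h' = -y := fun y => by rw [← map_neg, T.injective.eq_iff]
  simp [hx, hζ, or_and_right, exists_or, h1, h2, h5]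

theorem isSingularityA_three_of_linearStabilizer {q x a : ℍ[ℝ]} (hq : q * q = -1)
    (ha : a * a = -1) (hx : linearStabilizer x = {1, -1, a, -a}) :
    IsSingularityA q 3 (proj x) := by
  obtain ⟨T, hT, hTa⟩ := exists_coordinates ha hq
  refine isSingularityA_of_coordinates T hT fun h h' => ?_
  have hζ : ∀ ζ : ℂ, ζ ^ (3 + 1) = 1 ↔ ζ = 1 ∨ ζ = -1 ∨ ζ = Complex.I ∨ ζ = -Complex.I := by
    intro ζ
    constructor
    · intro h
      have h1 : (ζ - 1) * ((ζ + 1) * ((ζ - Complex.I) * (ζ + Complex.I))) = 0 := by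
        linear_combination h + (1 - ζ ^ 2) * Complex.I_sq
      rcases mul_eq_zero.1 h1 with h | h
      · exact Or.inl (sub_eq_zero.1 h)
      rcases mul_eq_zero.1 h with h | h
      · exact Or.inr (Or.inl (eq_neg_of_add_eq_zero_left h))
      rcases mul_eq_zero.1 h with h | h
      · exact Or.inr (Or.inr (Or.inl (sub_eq_zero.1 h)))
      · exact Or.inr (Or.inr (Or.inr (eq_neg_of_add_eq_zero_left h)))
    · rintro (rfl | rfl | rfl | rfl) <;> norm_num
  have h1 : ((T h).1, (T h).2) = T h := rfl
  have h2 : (-(T h).1, -(T h).2) = T (-h) := by rw [map_neg]; rfl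
  have h3 : (Complex.I * (T h).1, -(Complex.I * (T h).2)) = T (a * h) := by
    rw [hTa, neg_mul]
  have h4 : (-(Complex.I * (T h).1), Complex.I * (T h).2) = T (-(a * h)) := by
    rw [map_neg, hTa]
    simp
  have h5 : ∀ y, T h' = -T y ↔ h' = -y := fun y => by rw [← map_neg, T.injective.eq_iff]
  simp [hx, hζ, or_and_right, exists_or, h1, h2, h3, h4, h5]

/-! ### Stabilizers of points of the torus -/

theorem mul_self_eq_autNeg {p : hurwitzˣ × Torus} (hp : p ∈ affinePairs) :
    p = (1, 0) ∨ p = (-1, 0) ∨ affine p.1 p.2 * affine p.1 p.2 = autNeg := by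
  have hneg : ∀ (l : hurwitzˣ) (r : Torus), -r = r → affine l r * affine l r = autNeg →
      affine (-l) r * affine (-l) r = autNeg := by
    intro l r hr h
    have hc : affine (-l) r = affine l r * autNeg := by
      rw [autNeg, affine_mul, map_zero, zero_add, mul_neg_one]
    nth_rewrite 1 [hc]
    rw [affine_neg l r hr, mul_assoc, ← mul_assoc autNeg, autNeg_mul_autNeg, one_mul, h]
  have hI : affine unitI 0 * affine unitI 0 = autNeg := autI_mul_autI
  have hJ : affine unitJ alpha * affine unitJ alpha = autNeg := autJ_mul_autJ
  have hK : affine unitK alpha * affine unitK alpha = autNeg := by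
    simp [autNeg, affine_mul, unitK_mul_unitK, leftMul_alpha_K, alpha_add_alpha]
  simp only [affinePairs, Set.mem_insert_iff, Set.mem_singleton_iff] at hp
  rcases hp with rfl | rfl | rfl | rfl | rfl | rfl | rfl | rfl
  · exact Or.inl rfl
  · exact Or.inr (Or.inl rfl)
  · exact Or.inr (Or.inr hI)
  · exact Or.inr (Or.inr (hneg _ _ neg_zero hI))
  · exact Or.inr (Or.inr hJ)
  · exact Or.inr (Or.inr (hneg _ _ neg_alpha hJ))
  · exact Or.inr (Or.inr hK)
  · exact Or.inr (Or.inr (hneg _ _ neg_alpha hK))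

theorem autNeg_apply (x : Torus) : autNeg x = -x := by
  rw [autNeg, affine_apply, leftMul_neg_one, add_zero]

theorem mem_twoTorsion_iff {x : Torus} : x ∈ twoTorsion ↔ -x = x := by
  rw [neg_eq_iff_add_eq_zero]
  rfl

/-- Every nontrivial subgroup of the group contains `-1`, so only `2`-torsion points have nontrivial
stabilizer. -/
theorem mem_twoTorsion_of_affine_eq {p : hurwitzˣ × Torus} (hp : p ∈ affinePairs)
    (h1 : p ≠ (1, 0)) {x : Torus} (hx : affine p.1 p.2 x = x) : x ∈ twoTorsion := by
  rw [mem_twoTorsion_iff, ← autNeg_apply]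
  rcases mul_self_eq_autNeg hp with h | h | h
  · exact absurd h h1
  · rw [h] at hx
    exact hx
  · rw [← h, Equiv.Perm.mul_apply, hx, hx]

theorem linearStabilizer_of_notMem_twoTorsion {x : ℍ[ℝ]} (hx : toTorus x ∉ twoTorsion) :
    linearStabilizer x = {1} := by
  ext a
  constructor
  · rintro ⟨p, hp, hpx, rfl⟩
    by_cases h1 : p = (1, 0)
    · rw [h1]
      rfl
    · exact absurd (mem_twoTorsion_of_affine_eq hp h1 hpx) hx
  · rintro rfl
    exact ⟨(1, 0), Or.inl rfl, by rw [affine_one]; rfl, rfl⟩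

theorem affine_neg_apply {l : hurwitzˣ} {r : Torus} (hr : -r = r) {x : Torus}
    (hx : x ∈ twoTorsion) : affine (-l) r x = affine l r x := by
  have h : affine l r x = -(affine l r x) := by
    conv_lhs => rw [affine_apply, ← mem_twoTorsion_iff.1 hx, map_neg, ← hr]
    rw [affine_apply]
    abel
  rw [affine_neg l r hr, Equiv.Perm.mul_apply, autNeg_apply, ← h]

theorem mem_linearStabilizer_iff {x a : ℍ[ℝ]} (hx : toTorus x ∈ twoTorsion) :
    a ∈ linearStabilizer x ↔ (a = 1 ∨ a = -1) ∨
      (toTorus x ∈ fix autI ∧ (a = quat 0 1 0 0 ∨ a = -quat 0 1 0 0)) ∨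
      (toTorus x ∈ fix autJ ∧ (a = quat 0 0 1 0 ∨ a = -quat 0 0 1 0)) ∨
      (toTorus x ∈ fix autK ∧ (a = quat 0 0 0 1 ∨ a = -quat 0 0 0 1)) := by
  have hI : ((unitI : hurwitz) : ℍ[ℝ]) = quat 0 1 0 0 := rfl
  have hJ : ((unitJ : hurwitz) : ℍ[ℝ]) = quat 0 0 1 0 := rfl
  have hK : ((unitK : hurwitz) : ℍ[ℝ]) = quat 0 0 0 1 := rfl
  have h1 : affine 1 0 (toTorus x) = toTorus x := by rw [affine_one]; rfl
  simp only [linearStabilizer, affinePairs, Set.mem_ofPred_eq, Set.mem_insert_iff,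
    Set.mem_singleton_iff, exists_eq_or_imp, exists_eq_left,
    affine_neg_apply neg_zero hx, affine_neg_apply neg_alpha hx, h1, Units.val_neg,
    Units.val_one, Subring.coe_neg, Subring.coe_one, hI, hJ, hK, true_and, fix, autI, autJ, autK]
  tauto

/-! ### The sixteen `2`-torsion points -/

/-- The coordinates modulo `2`, in the basis `1, i, j, t`, of twice a `2`-torsion point. -/
abbrev Coord : Type := ZMod 2 × ZMod 2 × ZMod 2 × ZMod 2

/-- The class of `(a + b i + c j + d t) / 2`. -/
noncomputable def halfInt (a b c d : ℤ) : Torus :=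
  toTorus (quat (a / 2 + d / 4) (b / 2 + d / 4) (c / 2 + d / 4) (d / 4))

theorem halfInt_eq_iff {a b c d a' b' c' d' : ℤ} :
    halfInt a b c d = halfInt a' b' c' d' ↔ ((a : ZMod 2) = a' ∧ (b : ZMod 2) = b' ∧
      (c : ZMod 2) = c' ∧ (d : ZMod 2) = d') := by
  simp only [ZMod.intCast_eq_intCast_iff_dvd_sub, halfInt, toTorus_eq_iff]
  constructor
  · rintro ⟨m, n, k, l, h⟩
    have h0 := congrArg QuaternionAlgebra.re h
    have h1 := congrArg QuaternionAlgebra.imI h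
    have h2 := congrArg QuaternionAlgebra.imJ h
    have h3 := congrArg QuaternionAlgebra.imK h
    simp at h0 h1 h2 h3
    have e3 : d' - d = 2 * l := by
      have : (d' : ℝ) - d = 2 * l := by linarith
      exact_mod_cast this
    have e0 : a' - a = 2 * m := by
      have : (a' : ℝ) - a = 2 * m := by linarith
      exact_mod_cast this
    have e1 : b' - b = 2 * n := by
      have : (b' : ℝ) - b = 2 * n := by linarith
      exact_mod_cast this
    have e2 : c' - c = 2 * k := by
      have : (c' : ℝ) - c = 2 * k := by linarith
      exact_mod_cast this
    exact ⟨⟨m, e0⟩, ⟨n, e1⟩, ⟨k, e2⟩, ⟨l, e3⟩⟩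
  · rintro ⟨⟨m, e0⟩, ⟨n, e1⟩, ⟨k, e2⟩, ⟨l, e3⟩⟩
    have f0 : (a' : ℝ) - a = 2 * m := by exact_mod_cast e0
    have f1 : (b' : ℝ) - b = 2 * n := by exact_mod_cast e1
    have f2 : (c' : ℝ) - c = 2 * k := by exact_mod_cast e2
    have f3 : (d' : ℝ) - d = 2 * l := by exact_mod_cast e3
    refine mem_hurwitz_of m n k l ?_ ?_ ?_ ?_ <;> simp <;> linarith

/-- The `2`-torsion point with given coordinates. -/
noncomputable def half (v : Coord) : Torus :=
  halfInt v.1.val v.2.1.val v.2.2.1.val v.2.2.2.val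

theorem half_intCast (a b c d : ℤ) : half (a, b, c, d) = halfInt a b c d := by
  simp [half, halfInt_eq_iff]

theorem half_injective : Function.Injective half := by
  rintro ⟨a, b, c, d⟩ ⟨a', b', c', d'⟩ h
  have h := halfInt_eq_iff.1 h
  simpa using h

theorem range_half : Set.range half = twoTorsion := by
  ext x
  constructor
  · rintro ⟨v, rfl⟩
    refine toTorus_eq_zero_iff.2 (mem_hurwitz_of v.1.val v.2.1.val v.2.2.1.val v.2.2.2.val
      ?_ ?_ ?_ ?_) <;> simp <;> ring
  · intro hx
    obtain ⟨x, rfl⟩ := QuotientAddGroup.mk_surjective x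
    have hx : toTorus (x + x) = 0 := hx
    obtain ⟨a, b, c, d, h⟩ := toTorus_eq_zero_iff.1 hx
    refine ⟨(a, b, c, d), ?_⟩
    rw [half_intCast]
    refine congrArg toTorus ?_
    have h0 := congrArg QuaternionAlgebra.re h
    have h1 := congrArg QuaternionAlgebra.imI h
    have h2 := congrArg QuaternionAlgebra.imJ h
    have h3 := congrArg QuaternionAlgebra.imK h
    simp at h0 h1 h2 h3
    ext <;> simp <;> linarith

/-- The action of `i` on the `2`-torsion points. -/
def actI (v : Coord) : Coord :=
  (v.2.1 + v.2.2.1 + v.2.2.2, v.1 + v.2.2.1, v.2.2.1 + v.2.2.2, v.2.2.2)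

/-- The action of `j'` on the `2`-torsion points. -/
def actJ (v : Coord) : Coord :=
  (v.2.1 + v.2.2.1 + 1, v.2.1 + v.2.2.2 + 1, v.1 + v.2.1 + v.2.2.2, v.2.2.2)

theorem exists_intCast_eq (v : Coord) : ∃ a b c d : ℤ, v = ((a : ZMod 2), (b : ZMod 2),
    (c : ZMod 2), (d : ZMod 2)) :=
  ⟨v.1.val, v.2.1.val, v.2.2.1.val, v.2.2.2.val, by simp⟩

theorem two_eq_zero_zmod : (2 : ZMod 2) = 0 := rfl

theorem autI_half (v : Coord) : autI (half v) = half (actI v) := by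
  obtain ⟨a, b, c, d, rfl⟩ := exists_intCast_eq v
  have h1 : autI (halfInt a b c d) = halfInt (-b - c - d) (a - c) (-c - d) (2 * c + d) := by
    rw [autI, affine_apply, add_zero]
    refine congrArg toTorus ?_
    ext <;> simp [unitI] <;> ring
  rw [half_intCast, h1, ← half_intCast]
  refine congrArg half ?_
  push_cast
  simp only [actI, two_eq_zero_zmod, zero_mul, zero_add, sub_eq_add_neg, ZMod.neg_eq_self_mod_two]

theorem autJ_half (v : Coord) : autJ (half v) = half (actJ v) := by
  obtain ⟨a, b, c, d, rfl⟩ := exists_intCast_eq v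
  have h1 : autJ (halfInt a b c d) =
      halfInt (b - c + 1) (b + d + 1) (a + b + d) (-(2 * b) - d) := by
    rw [autJ, affine_apply]
    refine congrArg toTorus ?_
    ext <;> simp [unitJ] <;> ring
  rw [half_intCast, h1, ← half_intCast]
  refine congrArg half ?_
  push_cast
  simp only [actJ, two_eq_zero_zmod, zero_mul, zero_add, sub_eq_add_neg, ZMod.neg_eq_self_mod_two]

theorem autK_half (v : Coord) : autK (half v) = half (actI (actJ v)) := by
  rw [← autI_mul_autJ, Equiv.Perm.mul_apply, autJ_half, autI_half]

/-- The coordinate vectors fixed by a self-map. -/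
def fixedCoords (f : Coord → Coord) : Finset Coord := Finset.univ.filter fun v => f v = v

theorem fix_eq_image {g : Equiv.Perm Torus} {f : Coord → Coord}
    (hgf : ∀ v, g (half v) = half (f v)) (hg : fix g ⊆ twoTorsion) :
    fix g = half '' (fixedCoords f : Set Coord) := by
  ext x
  constructor
  · intro hx
    have hx' := hg hx
    rw [← range_half] at hx'
    obtain ⟨v, rfl⟩ := hx'
    refine ⟨v, ?_, rfl⟩
    have h : g (half v) = half v := hx
    rw [hgf] at h
    simpa [fixedCoords] using half_injective h
  · rintro ⟨v, hv, rfl⟩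
    have hv : f v = v := by simpa [fixedCoords] using hv
    show g (half v) = half v
    rw [hgf, hv]

theorem fix_subset_twoTorsion {p : hurwitzˣ × Torus} (hp : p ∈ affinePairs) (h1 : p ≠ (1, 0)) :
    fix (affine p.1 p.2) ⊆ twoTorsion := fun _ hx => mem_twoTorsion_of_affine_eq hp h1 hx

theorem fix_autI_subset : fix autI ⊆ twoTorsion :=
  fix_subset_twoTorsion (p := (unitI, 0)) (by simp [affinePairs]) fun h => by
    have h2 := congrArg (fun p : hurwitzˣ × Torus => ((p.1 : hurwitz) : ℍ[ℝ]).re) h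
    simp [unitI] at h2

theorem fix_autJ_subset : fix autJ ⊆ twoTorsion :=
  fix_subset_twoTorsion (p := (unitJ, alpha)) (by simp [affinePairs]) fun h => by
    have h2 := congrArg (fun p : hurwitzˣ × Torus => ((p.1 : hurwitz) : ℍ[ℝ]).re) h
    simp [unitJ] at h2

theorem fix_autK_subset : fix autK ⊆ twoTorsion :=
  fix_subset_twoTorsion (p := (unitK, alpha)) (by simp [affinePairs]) fun h => by
    have h2 := congrArg (fun p : hurwitzˣ × Torus => ((p.1 : hurwitz) : ℍ[ℝ]).re) h
    simp [unitK] at h2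

theorem fix_autI_eq : fix autI = half '' (fixedCoords actI : Set Coord) :=
  fix_eq_image autI_half fix_autI_subset

theorem fix_autJ_eq : fix autJ = half '' (fixedCoords actJ : Set Coord) :=
  fix_eq_image autJ_half fix_autJ_subset

theorem fix_autK_eq :
    fix autK = half '' (fixedCoords (fun v => actI (actJ v)) : Set Coord) :=
  fix_eq_image autK_half fix_autK_subset

/-- The orbit of a `2`-torsion point, on which `-1` acts trivially. -/
def orbitCoords (v : Coord) : Finset Coord := {v, actI v, actJ v, actI (actJ v)}

theorem exists_affine_half_eq_iff (v : Coord) (x : Torus) :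
    (∃ p ∈ affinePairs, affine p.1 p.2 (half v) = x) ↔ ∃ w ∈ orbitCoords v, half w = x := by
  have hv : half v ∈ twoTorsion := range_half ▸ Set.mem_range_self v
  have h1 : affine 1 0 (half v) = half v := by rw [affine_one]; rfl
  have hI : affine unitI 0 (half v) = half (actI v) := autI_half v
  have hJ : affine unitJ alpha (half v) = half (actJ v) := autJ_half v
  have hK : affine unitK alpha (half v) = half (actI (actJ v)) := autK_half v
  simp only [affinePairs, Set.mem_insert_iff, Set.mem_singleton_iff, exists_eq_or_imp,
    exists_eq_left, affine_neg_apply neg_zero hv, affine_neg_apply neg_alpha hv, h1, hI, hJ,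
    hK, orbitCoords, Finset.mem_insert, Finset.mem_singleton]
  tauto

theorem toQuotient_half_eq_iff (v w : Coord) :
    toQuotient (half v) = toQuotient (half w) ↔ w ∈ orbitCoords v := by
  rw [toQuotient_eq_iff, exists_affine_half_eq_iff]
  constructor
  · rintro ⟨w', hw', h⟩
    rwa [← half_injective h]
  · exact fun h => ⟨w, h, rfl⟩

theorem ncard_half_image (S : Finset Coord) : (half '' (S : Set Coord)).ncard = S.card := by
  rw [Set.ncard_image_of_injective _ half_injective, Set.ncard_coe_finset]

/-- The number of orbits is counted by a system of representatives. -/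
theorem ncard_toQuotient_image {S R : Finset Coord} (hRS : R ⊆ S)
    (h1 : ∀ v ∈ S, ∃ w ∈ R, w ∈ orbitCoords v) (h2 : ∀ v ∈ R, ∀ w ∈ R, w ∈ orbitCoords v → v = w) :
    (toQuotient '' (half '' (S : Set Coord))).ncard = R.card := by
  have h : toQuotient '' (half '' (S : Set Coord)) =
      (fun v => toQuotient (half v)) '' (R : Set Coord) := by
    rw [Set.image_image]
    apply Set.Subset.antisymm
    · rintro _ ⟨v, hv, rfl⟩
      obtain ⟨w, hw, hvw⟩ := h1 v hv
      exact ⟨w, hw, ((toQuotient_half_eq_iff v w).2 hvw).symm⟩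
    · exact Set.image_mono fun v hv => hRS hv
  have hinj : Set.InjOn (fun v => toQuotient (half v)) (R : Set Coord) := fun v hv w hw hvw =>
    h2 v hv w hw ((toQuotient_half_eq_iff v w).1 hvw)
  rw [h, hinj.ncard_image, Set.ncard_coe_finset]

/-- The coordinates of the points fixed by one of `i`, `j'`, `k'`. -/
def specialCoords : Finset Coord :=
  fixedCoords actI ∪ fixedCoords actJ ∪ fixedCoords fun v => actI (actJ v)

theorem fix_union_eq :
    fix autI ∪ fix autJ ∪ fix autK = half '' (specialCoords : Set Coord) := by
  rw [fix_autI_eq, fix_autJ_eq, fix_autK_eq, specialCoords, Finset.coe_union, Finset.coe_union,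
    Set.image_union, Set.image_union]

theorem twoTorsion_diff_eq : twoTorsion \ (fix autI ∪ fix autJ ∪ fix autK) =
    half '' ((specialCoordsᶜ : Finset Coord) : Set Coord) := by
  rw [fix_union_eq, ← range_half, ← Set.image_univ, Finset.coe_compl, Set.compl_eq_univ_sdiff,
    Set.image_sdiff half_injective]

theorem disjoint_fixedCoords :
    Disjoint (fixedCoords actI) (fixedCoords actJ) ∧
    Disjoint (fixedCoords actI) (fixedCoords fun v => actI (actJ v)) ∧
    Disjoint (fixedCoords actJ) (fixedCoords fun v => actI (actJ v)) := by
  decide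

theorem disjoint_fix : Disjoint (fix autI) (fix autJ) ∧ Disjoint (fix autI) (fix autK) ∧
    Disjoint (fix autJ) (fix autK) := by
  rw [fix_autI_eq, fix_autJ_eq, fix_autK_eq]
  obtain ⟨h1, h2, h3⟩ := disjoint_fixedCoords
  exact ⟨(Set.disjoint_image_iff half_injective).2 (Finset.disjoint_coe.2 h1),
    (Set.disjoint_image_iff half_injective).2 (Finset.disjoint_coe.2 h2),
    (Set.disjoint_image_iff half_injective).2 (Finset.disjoint_coe.2 h3)⟩

theorem ncard_toQuotient_fix_autI : (toQuotient '' fix autI).ncard = 2 := by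
  rw [fix_autI_eq, ncard_toQuotient_image (R := {(0, 0, 0, 0), (1, 0, 1, 0)})] <;> decide

theorem ncard_toQuotient_fix_autJ : (toQuotient '' fix autJ).ncard = 2 := by
  rw [fix_autJ_eq, ncard_toQuotient_image (R := {(1, 0, 0, 1), (0, 1, 0, 1)})] <;> decide

theorem ncard_toQuotient_fix_autK : (toQuotient '' fix autK).ncard = 2 := by
  rw [fix_autK_eq, ncard_toQuotient_image (R := {(0, 0, 0, 1), (1, 1, 0, 1)})] <;> decide

theorem ncard_toQuotient_fix_union :
    (toQuotient '' (fix autI ∪ fix autJ ∪ fix autK)).ncard = 6 := by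
  rw [fix_union_eq, ncard_toQuotient_image (R := {(0, 0, 0, 0), (1, 0, 1, 0), (1, 0, 0, 1),
    (0, 1, 0, 1), (0, 0, 0, 1), (1, 1, 0, 1)})] <;> decide

theorem half_one : half (1, 0, 0, 0) = toTorus (quat (1 / 2) 0 0 0) := by
  have h := half_intCast 1 0 0 0
  simp only [Int.cast_one, Int.cast_zero] at h
  rw [h]
  refine congrArg toTorus ?_
  ext <;> simp

/-- The `2`-torsion points not fixed by `i`, `j'` or `k'` are a single orbit. -/
theorem twoTorsion_diff_eq_orbit : twoTorsion \ (fix autI ∪ fix autJ ∪ fix autK) =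
    MulAction.orbit hatQ8 (toTorus (quat (1 / 2) 0 0 0)) := by
  have horb : (specialCoordsᶜ : Finset Coord) = orbitCoords (1, 0, 0, 0) := by decide
  rw [twoTorsion_diff_eq, horb, ← half_one]
  ext x
  have h : x ∈ MulAction.orbit hatQ8 (half (1, 0, 0, 0)) ↔
      ∃ p ∈ affinePairs, affine p.1 p.2 (half (1, 0, 0, 0)) = x := by
    rw [← toQuotient_eq_iff, eq_comm]
    exact (Quotient.eq (r := MulAction.orbitRel hatQ8 Torus)).symm
  rw [h, exists_affine_half_eq_iff]
  rfl

/-! ### Classification of the points of the quotient surface -/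

theorem isSmoothPoint_of_notMem {q : ℍ[ℝ]} (hq : q * q = -1) {x : Torus} (hx : x ∉ twoTorsion) :
    IsSmoothPoint q (toQuotient x) := by
  obtain ⟨x, rfl⟩ := QuotientAddGroup.mk_surjective x
  exact isSmoothPoint_of_linearStabilizer hq (linearStabilizer_of_notMem_twoTorsion hx)

theorem isSingularityA_one_of_mem {q : ℍ[ℝ]} (hq : q * q = -1) {x : Torus}
    (hx : x ∈ twoTorsion \ (fix autI ∪ fix autJ ∪ fix autK)) :
    IsSingularityA q 1 (toQuotient x) := by
  obtain ⟨x, rfl⟩ := QuotientAddGroup.mk_surjective x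
  obtain ⟨h2, hn⟩ := hx
  have hn' : toTorus x ∉ fix autI ∪ fix autJ ∪ fix autK := hn
  simp only [Set.mem_union, not_or] at hn'
  refine isSingularityA_one_of_linearStabilizer hq (Set.ext fun a => ?_)
  simp [mem_linearStabilizer_iff h2, hn']

theorem isSingularityA_three_of_mem {q : ℍ[ℝ]} (hq : q * q = -1) {x : Torus}
    (hx : x ∈ fix autI ∪ fix autJ ∪ fix autK) : IsSingularityA q 3 (toQuotient x) := by
  obtain ⟨x, rfl⟩ := QuotientAddGroup.mk_surjective x
  have hx : toTorus x ∈ fix autI ∪ fix autJ ∪ fix autK := hx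
  obtain ⟨hIJ, hIK, hJK⟩ := disjoint_fix
  have hii : quat 0 1 0 0 * quat 0 1 0 0 = -1 := by ext <;> simp
  have hjj : quat 0 0 1 0 * quat 0 0 1 0 = -1 := by ext <;> simp
  have hkk : quat 0 0 0 1 * quat 0 0 0 1 = -1 := by ext <;> simp
  rcases hx with (h | h) | h
  · refine isSingularityA_three_of_linearStabilizer hq hii (Set.ext fun a => ?_)
    simp [mem_linearStabilizer_iff (fix_autI_subset h), h, hIJ.notMem_of_mem_left h,
      hIK.notMem_of_mem_left h, or_assoc]
  · refine isSingularityA_three_of_linearStabilizer hq hjj (Set.ext fun a => ?_)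
    simp [mem_linearStabilizer_iff (fix_autJ_subset h), h, hIJ.notMem_of_mem_right h,
      hJK.notMem_of_mem_left h, or_assoc]
  · refine isSingularityA_three_of_linearStabilizer hq hkk (Set.ext fun a => ?_)
    simp [mem_linearStabilizer_iff (fix_autK_subset h), h, hIK.notMem_of_mem_right h,
      hJK.notMem_of_mem_right h, or_assoc]

theorem not_isSmoothPoint_of_isSingularityA {q : ℍ[ℝ]} {n : ℕ} (hn : n ≠ 0)
    {p : QuotientSurface} (h : IsSingularityA q n p) : ¬ IsSmoothPoint q p := fun hs =>
  not_germIso_holPlane hn ((GermIso.symm (holQuotient_congr q) hs).trans h)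

theorem not_isSingularityA_one_of_three {q : ℍ[ℝ]} {p : QuotientSurface}
    (h : IsSingularityA q 3 p) : ¬ IsSingularityA q 1 p := fun h1 =>
  not_germIso_aSurface_one (by norm_num) ((GermIso.symm (holQuotient_congr q) h).trans h1)

theorem setOf_isSingularityA_three {q : ℍ[ℝ]} (hq : q * q = -1) :
    {p | IsSingularityA q 3 p} = toQuotient '' (fix autI ∪ fix autJ ∪ fix autK) := by
  apply Set.Subset.antisymm
  · intro p hp
    obtain ⟨x, rfl⟩ := Quotient.mk_surjective p
    have hp : IsSingularityA q 3 (toQuotient x) := hp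
    by_cases h2 : x ∈ twoTorsion
    · by_contra hx
      exact not_isSingularityA_one_of_three hp
        (isSingularityA_one_of_mem hq ⟨h2, fun h => hx ⟨x, h, rfl⟩⟩)
    · exact absurd (isSmoothPoint_of_notMem hq h2)
        (not_isSmoothPoint_of_isSingularityA three_ne_zero hp)
  · rintro _ ⟨x, hx, rfl⟩
    exact isSingularityA_three_of_mem hq hx

theorem setOf_isSingularityA_one {q : ℍ[ℝ]} (hq : q * q = -1) :
    {p | IsSingularityA q 1 p} = {toQuotient (toTorus (quat (1 / 2) 0 0 0))} := by
  apply Set.Subset.antisymm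
  · intro p hp
    obtain ⟨x, rfl⟩ := Quotient.mk_surjective p
    have hp : IsSingularityA q 1 (toQuotient x) := hp
    by_cases h2 : x ∈ twoTorsion
    · by_cases hx : x ∈ fix autI ∪ fix autJ ∪ fix autK
      · exact absurd hp (not_isSingularityA_one_of_three (isSingularityA_three_of_mem hq hx))
      · have h : x ∈ twoTorsion \ (fix autI ∪ fix autJ ∪ fix autK) := ⟨h2, hx⟩
        rw [twoTorsion_diff_eq_orbit] at h
        exact Quotient.sound h
    · exact absurd (isSmoothPoint_of_notMem hq h2)
        (not_isSmoothPoint_of_isSingularityA one_ne_zero hp)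
  · rintro _ rfl
    refine isSingularityA_one_of_mem hq ?_
    rw [twoTorsion_diff_eq_orbit]
    exact MulAction.mem_orbit_self _

theorem setOf_not_isSmoothPoint {q : ℍ[ℝ]} (hq : q * q = -1) :
    {p | ¬ IsSmoothPoint q p} = {p | IsSingularityA q 3 p} ∪ {p | IsSingularityA q 1 p} := by
  apply Set.Subset.antisymm
  · intro p hp
    obtain ⟨x, rfl⟩ := Quotient.mk_surjective p
    have hp : ¬ IsSmoothPoint q (toQuotient x) := hp
    by_cases hx : x ∈ fix autI ∪ fix autJ ∪ fix autK
    · exact Or.inl (isSingularityA_three_of_mem hq hx)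
    · by_cases h2 : x ∈ twoTorsion
      · exact Or.inr (isSingularityA_one_of_mem hq ⟨h2, hx⟩)
      · exact absurd (isSmoothPoint_of_notMem hq h2) hp
  · rintro p (hp | hp)
    · exact not_isSmoothPoint_of_isSingularityA three_ne_zero hp
    · exact not_isSmoothPoint_of_isSingularityA one_ne_zero hp

theorem exists_mem_hatQ8_apply_ne (x : Torus) : ∃ g ∈ hatQ8, g x ≠ x := by
  by_contra! h
  exact disjoint_fix.1.notMem_of_mem_left (h autI (by simp [hatQ8])) (h autJ (by simp [hatQ8]))

theorem fix_subset_and_ncard {g : Equiv.Perm Torus}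
    (hg : g ∈ ({autI, autJ, autK} : Set (Equiv.Perm Torus))) :
    fix g ⊆ twoTorsion ∧ (fix g).ncard = 4 ∧ (toQuotient '' fix g).ncard = 2 := by
  rcases hg with rfl | rfl | rfl
  · refine ⟨fix_autI_subset, ?_, ncard_toQuotient_fix_autI⟩
    rw [fix_autI_eq, ncard_half_image]
    decide
  · refine ⟨fix_autJ_subset, ?_, ncard_toQuotient_fix_autJ⟩
    rw [fix_autJ_eq, ncard_half_image]
    decide
  · refine ⟨fix_autK_subset, ?_, ncard_toQuotient_fix_autK⟩
    rw [fix_autK_eq, ncard_half_image]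
    decide

theorem ncard_twoTorsion_diff : (twoTorsion \ (fix autI ∪ fix autJ ∪ fix autK)).ncard = 4 := by
  rw [twoTorsion_diff_eq, ncard_half_image]
  decide

end QuaternionTorus

theorem mainTheorem9 (q : ℍ[ℝ]) (hq : q ^ 2 = -1) :
    -- no point of the torus is fixed by the whole group
    (∀ x : QuaternionTorus.Torus, ∃ g ∈ QuaternionTorus.hatQ8, g x ≠ x) ∧
    -- exactly six singularities of type `A₃`, exactly one of type `A₁`, and no other one
    {p | QuaternionTorus.IsSingularityA q 3 p}.ncard = 6 ∧
    {p | QuaternionTorus.IsSingularityA q 1 p}.ncard = 1 ∧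
    {p | ¬ QuaternionTorus.IsSmoothPoint q p} =
      {p | QuaternionTorus.IsSingularityA q 3 p} ∪ {p | QuaternionTorus.IsSingularityA q 1 p} ∧
    Disjoint {p | QuaternionTorus.IsSingularityA q 3 p}
      {p | QuaternionTorus.IsSingularityA q 1 p} ∧
    -- the fixed points of `i`, `j'`, `k'`: four `2`-torsion points each, with two images each
    (∀ g ∈ ({QuaternionTorus.autI, QuaternionTorus.autJ, QuaternionTorus.autK} :
        Set (Equiv.Perm QuaternionTorus.Torus)),
      QuaternionTorus.fix g ⊆ QuaternionTorus.twoTorsion ∧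
      (QuaternionTorus.fix g).ncard = 4 ∧
      (QuaternionTorus.toQuotient '' QuaternionTorus.fix g).ncard = 2) ∧
    -- these images are the `A₃` points
    {p | QuaternionTorus.IsSingularityA q 3 p} =
      QuaternionTorus.toQuotient '' (QuaternionTorus.fix QuaternionTorus.autI ∪
        QuaternionTorus.fix QuaternionTorus.autJ ∪ QuaternionTorus.fix QuaternionTorus.autK) ∧
    -- the remaining `2`-torsion points are four, they form the orbit of `1/2`, and their image
    -- is the `A₁` point
    (QuaternionTorus.twoTorsion \ (QuaternionTorus.fix QuaternionTorus.autI ∪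
      QuaternionTorus.fix QuaternionTorus.autJ ∪
      QuaternionTorus.fix QuaternionTorus.autK)).ncard = 4 ∧
    QuaternionTorus.twoTorsion \ (QuaternionTorus.fix QuaternionTorus.autI ∪
      QuaternionTorus.fix QuaternionTorus.autJ ∪ QuaternionTorus.fix QuaternionTorus.autK) =
      MulAction.orbit QuaternionTorus.hatQ8 (QuaternionTorus.toTorus (QuaternionTorus.quat (1 / 2) 0 0 0)) ∧
    {p | QuaternionTorus.IsSingularityA q 1 p} =
      {QuaternionTorus.toQuotient (QuaternionTorus.toTorus (QuaternionTorus.quat (1 / 2) 0 0 0))} := by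
  have hq' : q * q = -1 := by rw [← sq, hq]
  refine ⟨QuaternionTorus.exists_mem_hatQ8_apply_ne, ?_, ?_,
    QuaternionTorus.setOf_not_isSmoothPoint hq', ?_,
    fun g hg => QuaternionTorus.fix_subset_and_ncard hg,
    QuaternionTorus.setOf_isSingularityA_three hq', QuaternionTorus.ncard_twoTorsion_diff,
    QuaternionTorus.twoTorsion_diff_eq_orbit, QuaternionTorus.setOf_isSingularityA_one hq'⟩
  · rw [QuaternionTorus.setOf_isSingularityA_three hq']
    exact QuaternionTorus.ncard_toQuotient_fix_union
  · rw [QuaternionTorus.setOf_isSingularityA_one hq', Set.ncard_singleton]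
  · exact Set.disjoint_left.2 fun p h3 h1 => QuaternionTorus.not_isSingularityA_one_of_three h3 h1
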